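/- Let $\mathbb T=\mathbb R/2\pi\mathbb Z$. For $k\in\mathbb Z$ put $|k|_*=|k|$ if $k\neq0$ and $|0|_*=1$, and write $\langle x\rangle=\sqrt{1+x^2}$. For $s\in\mathbb R$, $H^s(\mathbb T)$ is the Sobolev space with norm $\|v\|_{H^s}^2=\sum_{k\in\mathbb Z}|k|_*^{2s}|\hat v(k)|^2$. For an open set $\omega\subset\mathbb T$, $H^s(\omega)$ is the space of restrictions to $\omega$ of elements of $H^s(\mathbb T)$. For $s,b\in\mathbb R$, the Bourgain space $X^{s,b}$ consists of the distributions $u(t,x)$ on $\mathbb R\times\mathbb T$ whose space-time Fourier transform $\hat{\hat u}(\tau,k)$ is a measurable function with $$\|u\|_{X^{s,b}}^2=\sum_{k\in\mathbb Z}\int_{\mathbb R}|k|_*^{2s}\,\langle\tau+k^2\rangle^{2b}\,|\hat{\hat u}(\tau,k)|^2\,d\tau<\infty ,$$ and $X^{s,b}_T$ is the space of restrictions to $]0,T[\times\mathbb T$ of elements of $X^{s,b}$. **Theorem (propagation of regularity).** Let $T>0$, $0\le b<1$, $r\in\mathbb R$, and let $u\in X^{r,b}_T$ be a solution, in the sense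 of distributions on $]0,T[\times\mathbb T$, of $$i\partial_t u+\partial_x^2u=f,\qquad f\in X^{r,-b}_T .$$ Suppose that there are a nonempty open set $\omega\subset\mathbb T$ and a real number $\rho\le\frac{1-b}{2}$ such that $u\in L^2_{\mathrm{loc}}(]0,T[,H^{r+\rho}(\omega))$. Then $u\in L^2_{\mathrm{loc}}(]0,T[,H^{r+\rho}(\mathbb T))$. -/

import Mathlib

open MeasureTheory Set Real TopologicalSpace
open scoped ENNReal Distributions LineDeriv CompactConvergenceCLM

namespace SchrodingerTorus

noncomputable section

/-! The torus is `𝕋 = ℝ / 2πℤ`.  A distribution on `I × 𝕋` (with `I ⊆ ℝ` open) is represented by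
its lift, a (`2π`-periodic in the second variable) distribution on `I × ℝ` in the sense of Mathlib.
The first variable is the time `t`, the second one is the space variable `x`.  Periodicity is not a
separate hypothesis: it follows from membership in the spaces below, all of whose members are
given by Fourier series in `x`. -/

/-- The torus `𝕋 = ℝ / 2πℤ`. -/
abbrev Torus : Type := AddCircle (2 * π)

/-- The lift `]0,T[ × {x ∈ ℝ : x mod 2π ∈ ω}` of `]0,T[ × ω`, where `ω ⊆ 𝕋` is open. -/
def cylinder (T : ℝ) (ω : Opens Torus) : Opens (ℝ × ℝ) :=
  ⟨{p | p.1 ∈ Ioo 0 T ∧ ((p.2 : ℝ) : Torus) ∈ ω},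
    (isOpen_Ioo.preimage continuous_fst).inter
      (ω.isOpen.preimage ((AddCircle.continuous_mk' (2 * π)).comp continuous_snd))⟩

/-- Restriction of a distribution on `U` to an open subset `V ⊆ U`. -/
def restrict {U V : Opens (ℝ × ℝ)} (_h : V ≤ U) (u : 𝓓'(U, ℂ)) : 𝓓'(V, ℂ) :=
  ContinuousLinearMap.comp u (TestFunction.monoCLM ℝ : 𝓓(V, ℝ) →L[ℝ] 𝓓(U, ℝ))

/-- `restrict` does what it should: it tests `u` against the same function, seen as a test
function on the larger open set. -/
theorem restrict_apply {U V : Opens (ℝ × ℝ)} (h : V ≤ U) (u : 𝓓'(U, ℂ)) (φ : 𝓓(V, ℝ)) :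
    ∃ ψ : 𝓓(U, ℝ), (⇑ψ = ⇑φ) ∧ restrict h u φ = u ψ := by
  refine ⟨TestFunction.monoCLM ℝ φ, ?_, rfl⟩
  ext p
  simp [TestFunction.monoCLM_apply, h]

theorem cylinder_mono (T : ℝ) {ω ω' : Opens Torus} (h : ω ≤ ω') :
    cylinder T ω ≤ cylinder T ω' :=
  fun _ hp => ⟨hp.1, h hp.2⟩

/-- The modified absolute value of a frequency: `|k|` if `k ≠ 0`, and `1` if `k = 0`. -/
def freq (k : ℤ) : ℝ := if k = 0 then 1 else |(k : ℝ)|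

/-- The Japanese bracket `⟨x⟩ = √(1 + x²)`. -/
def bracket (x : ℝ) : ℝ := √(1 + x ^ 2)

/-- The square of the norm of `H^s(𝕋)`, on the Fourier coefficients `a` of a distribution on `𝕋`:
`|a 0|² + ∑_{k ≠ 0} |k|^{2s} |a k|²`. -/
def sobolevNormSq (s : ℝ) (a : ℤ → ℂ) : ℝ≥0∞ :=
  ∑' k : ℤ, ENNReal.ofReal (freq k ^ (2 * s)) * ‖a k‖ₑ ^ 2

/-- The square of the norm of `X^{s,b}`, on the space-time Fourier transform `g τ k`:
`∑_k ∫ |k|^{2s} ⟨τ + k²⟩^{2b} |g τ k|² dτ`, with `|k|` replaced by `1` for `k = 0`. -/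
def bourgainNormSq (s b : ℝ) (g : ℝ → ℤ → ℂ) : ℝ≥0∞ :=
  ∑' k : ℤ, ∫⁻ τ : ℝ,
    ENNReal.ofReal (freq k ^ (2 * s) * bracket (τ + (k : ℝ) ^ 2) ^ (2 * b)) * ‖g τ k‖ₑ ^ 2

/-- The distribution `u` on `ℝ × 𝕋` has the space-time Fourier transform `g`, that is
`u(t,x) = ∑_k e^{ikx} (2π)⁻¹ ∫ g(τ,k) e^{itτ} dτ` in the sense of distributions. -/
def HasSpaceTimeFourier (u : 𝓓'((⊤ : Opens (ℝ × ℝ)), ℂ)) (g : ℝ → ℤ → ℂ) : Prop :=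
  ∀ φ : 𝓓((⊤ : Opens (ℝ × ℝ)), ℝ),
    HasSum (fun k : ℤ => (2 * π : ℂ)⁻¹ * ∫ τ : ℝ, g τ k *
      ∫ p : ℝ × ℝ, (φ p : ℂ) * Complex.exp (Complex.I * (τ * p.1 + k * p.2))) (u φ)

/-- The Bourgain space `X^{s,b}` of distributions on `ℝ × 𝕋`. -/
def MemX (s b : ℝ) (u : 𝓓'((⊤ : Opens (ℝ × ℝ)), ℂ)) : Prop :=
  ∃ g : ℝ → ℤ → ℂ, (∀ k, AEStronglyMeasurable (fun τ => g τ k) volume) ∧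
    bourgainNormSq s b g < ∞ ∧ HasSpaceTimeFourier u g

/-- The restriction space `X^{s,b}_T` of distributions on `]0,T[ × 𝕋`. -/
def MemXT (s b T : ℝ) (u : 𝓓'(cylinder T ⊤, ℂ)) : Prop :=
  ∃ w : 𝓓'((⊤ : Opens (ℝ × ℝ)), ℂ), MemX s b w ∧ restrict le_top w = u

/-- The distribution `u` on `]0,T[ × 𝕋` is `∑_k c(t,k) e^{ikx}` in the sense of distributions. -/
def HasSpaceFourier (T : ℝ) (u : 𝓓'(cylinder T ⊤, ℂ)) (c : ℝ → ℤ → ℂ) : Prop :=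
  ∀ φ : 𝓓(cylinder T ⊤, ℝ),
    HasSum (fun k : ℤ => ∫ t in Ioo 0 T, c t k *
      ∫ x : ℝ, (φ (t, x) : ℂ) * Complex.exp (Complex.I * (k * x))) (u φ)

/-- `u ∈ L²_loc(]0,T[, H^s(𝕋))`. -/
def MemL2locH (s T : ℝ) (u : 𝓓'(cylinder T ⊤, ℂ)) : Prop :=
  ∃ c : ℝ → ℤ → ℂ,
    (∀ k, AEStronglyMeasurable (fun t => c t k) (volume.restrict (Ioo 0 T))) ∧
    (∀ K : Set ℝ, IsCompact K → K ⊆ Ioo 0 T → ∫⁻ t in K, sobolevNormSq s (c t) < ∞) ∧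
    HasSpaceFourier T u c

/-- `u ∈ L²_loc(]0,T[, H^s(ω))`, where `H^s(ω)` is the space of restrictions to the open set
`ω ⊆ 𝕋` of elements of `H^s(𝕋)`: on `]0,T[ × ω`, `u` coincides with some element of
`L²_loc(]0,T[, H^s(𝕋))`. -/
def MemL2locHOn (s T : ℝ) (ω : Opens Torus) (u : 𝓓'(cylinder T ⊤, ℂ)) : Prop :=
  ∃ v : 𝓓'(cylinder T ⊤, ℂ), MemL2locH s T v ∧
    restrict (cylinder_mono T (le_top : ω ≤ ⊤)) u = restrict (cylinder_mono T (le_top : ω ≤ ⊤)) v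

/-- The Schrödinger operator `i ∂ₜ u + ∂ₓ² u`, in the sense of distributions on `]0,T[ × 𝕋`. -/
def schrodinger {T : ℝ} (u : 𝓓'(cylinder T ⊤, ℂ)) : 𝓓'(cylinder T ⊤, ℂ) :=
  Complex.I • (∂_{((1 : ℝ), (0 : ℝ))} u : 𝓓'(cylinder T ⊤, ℂ)) +
    ∂_{((0 : ℝ), (1 : ℝ))} (∂_{((0 : ℝ), (1 : ℝ))} u : 𝓓'(cylinder T ⊤, ℂ))

end

end SchrodingerTorus

/-! The proof is an elementary `ℓ²` argument on Fourier coefficients. Let `χ` be a cutoff in time.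
The Schrödinger operator sends `χu` to `iχ'u + χf`, and both terms lie in `X^{r,-b}` because `b ≥
0`; hence `χu` lies in `X^{r,1-b}` (`bourgainNormSq_localCoeff_lt_top`). Let `G_k(τ)` be the
space-time Fourier transform of `χu` and `C_k(τ)` that of `χv`, where `v` has regularity `r + ρ` and
coincides with `u` on `ω`.

Choose `φ` supported over `ω` with nonzero mean. Then `φχ(u - v) = 0`, which reads `∑_k p(k-n)(G_k -
C_k) = 0` with `p` rapidly decreasing and `p 0 ≠ 0` (`hasSum_localCoeff_sub`). Isolating `k = n`
bounds `|p 0||G_n|` by a convolution of the `|C_k|`, which has the desired regularity, plus the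
off-diagonal sum of the `|p(k-n)||G_k|`. Multiplying by `|G_n|` leaves products `|G_n||G_k|` with `k
≠ n`, and these are better than their factors: the difference of `τ + n²` and `τ + k²` is `n² - k²`,
which dominates `|n|` and `|k|` unless `k = -n`, so the two brackets cannot both be small. If `k =
-n`, then `|k - n| = 2|n|` and the decay of `p` pays instead (`freq_mul_freq_le`).

Spending `σ = 1 - b` powers of each bracket buys `σ/2` powers of each frequency, which is the origin
of `ρ ≤ (1-b)/2`. The off-diagonal terms are controlled by the `X^{r,1-b}` norm, already finite, so
there is no absorption and no bootstrap (`tsum_lintegral_lt_top_of_bourgain`). Plancherel in time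
converts the result to `L²_loc`. -/

namespace SchrodingerTorus

/-! ### Fourier transform on the line: Plancherel, duality, decay. -/

noncomputable section

open FourierTransform SchwartzMap
open scoped ContDiff

/-- The Fourier transform `∫ α(t) e^{iτt} dt` without normalization. -/
def ft (α : ℝ → ℂ) (τ : ℝ) : ℂ := ∫ t : ℝ, α t * Complex.exp (Complex.I * (τ * t))

theorem ft_eq_fourier (α : ℝ → ℂ) (τ : ℝ) : ft α τ = 𝓕 α (-(2 * π)⁻¹ * τ) := by
  rw [Real.fourier_real_eq_integral_exp_smul]
  refine integral_congr_ae (.of_forall fun t => ?_)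
  have : (π : ℂ) ≠ 0 := by exact_mod_cast Real.pi_ne_zero
  simp only [smul_eq_mul, mul_comm (α t)]
  congr 2
  push_cast
  field_simp

theorem ft_eq_fourier_fun (α : ℝ → ℂ) : ft α = fun τ => 𝓕 α (-(2 * π)⁻¹ * τ) :=
  funext (ft_eq_fourier α)

theorem integral_fourier_mul_eq_of_integrable {f φ : ℝ → ℂ} (hf : Integrable f)
    (hφ : Integrable φ) : ∫ x, 𝓕 f x * φ x = ∫ x, f x * 𝓕 φ x := by
  have := VectorFourier.integral_fourierIntegral_smul_eq_flip (μ := (volume : Measure ℝ))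
    (ν := (volume : Measure ℝ)) (L := innerₗ ℝ) (f := f) (g := φ)
    Real.continuous_fourierChar (by fun_prop) hf hφ
  rw [flip_innerₗ] at this
  exact this

/-- On `L¹ ∩ L²`, the Fourier transform of `L²` is given by the integral. -/
theorem Lp_fourier_ae_eq {f : ℝ → ℂ} (hf : Integrable f) (hf2 : MemLp f 2) :
    ⇑(𝓕 (hf2.toLp f) : Lp ℂ 2 (volume : Measure ℝ)) =ᵐ[volume] 𝓕 f := by
  refine ae_eq_of_integral_contDiff_smul_eq
    ((Lp.memLp _).locallyIntegrable (by norm_num)) ?_ ?_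
  · refine Continuous.locallyIntegrable ?_
    exact VectorFourier.fourierIntegral_continuous Real.continuous_fourierChar (by fun_prop) hf
  · intro g hg hgc
    have hg₁ : HasCompactSupport (Complex.ofRealCLM ∘ g) := hgc.comp_left rfl
    have hg₂ : ContDiff ℝ ∞ (Complex.ofRealCLM ∘ g) := by fun_prop
    set φ := hg₁.toSchwartzMap hg₂ with hφ
    have h1 := DFunLike.congr_fun (Lp.fourier_toTemperedDistribution_eq (hf2.toLp f)) φ
    rw [TemperedDistribution.fourier_apply, Lp.toTemperedDistribution_apply,
      Lp.toTemperedDistribution_apply] at h1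
    have h2 : ∀ x, φ x = (g x : ℂ) := fun x => rfl
    calc ∫ x, g x • (𝓕 (hf2.toLp f) : Lp ℂ 2 (volume : Measure ℝ)) x
        = ∫ x, φ x • (𝓕 (hf2.toLp f) : Lp ℂ 2 (volume : Measure ℝ)) x := by
          simp [h2]
      _ = ∫ x, (𝓕 φ) x • (hf2.toLp f) x := h1.symm
      _ = ∫ x, f x * 𝓕 (φ : ℝ → ℂ) x := by
          refine integral_congr_ae ?_
          filter_upwards [hf2.coeFn_toLp] with x hx
          rw [hx, smul_eq_mul, mul_comm]; rfl
      _ = ∫ x, 𝓕 f x * φ x := (integral_fourier_mul_eq_of_integrable hf φ.integrable).symm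
      _ = ∫ x, g x • 𝓕 f x := by simp [h2, mul_comm]

theorem lintegral_fourier_sq {f : ℝ → ℂ} (hf : Integrable f) (hf2 : MemLp f 2) :
    ∫⁻ x, ‖𝓕 f x‖ₑ ^ 2 = ∫⁻ x, ‖f x‖ₑ ^ 2 := by
  have key : ∀ F : Lp ℂ 2 (volume : Measure ℝ), ∫⁻ x, ‖F x‖ₑ ^ 2 = ‖F‖ₑ ^ 2 := by
    intro F
    rw [Lp.enorm_def, eLpNorm_eq_lintegral_rpow_enorm_toReal (by norm_num) (by norm_num)]
    simp only [ENNReal.toReal_ofNat, ENNReal.rpow_ofNat]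
    rw [← ENNReal.rpow_natCast, ← ENNReal.rpow_mul]
    norm_num
  have h1 : ∫⁻ x, ‖𝓕 f x‖ₑ ^ 2
      = ∫⁻ x, ‖(𝓕 (hf2.toLp f) : Lp ℂ 2 (volume : Measure ℝ)) x‖ₑ ^ 2 := by
    refine lintegral_congr_ae ?_
    filter_upwards [Lp_fourier_ae_eq hf hf2] with x hx
    rw [hx]
  have h2 : ∫⁻ x, ‖f x‖ₑ ^ 2 = ∫⁻ x, ‖(hf2.toLp f) x‖ₑ ^ 2 := by
    refine lintegral_congr_ae ?_
    filter_upwards [hf2.coeFn_toLp] with x hx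
    rw [hx]
  rw [h1, h2, key, key, ← ofReal_norm, ← ofReal_norm, Lp.norm_fourier_eq]

theorem lintegral_comp_mul_left (a : ℝ) (ha : a ≠ 0) (f : ℝ → ℝ≥0∞) :
    ∫⁻ x, f (a * x) = ENNReal.ofReal |a⁻¹| * ∫⁻ x, f x := by
  have h := (Homeomorph.mulLeft₀ a ha).toMeasurableEquiv.measurableEmbedding.lintegral_map
    (μ := volume) f
  have h' : Measure.map (Homeomorph.mulLeft₀ a ha).toMeasurableEquiv volume
      = ENNReal.ofReal |a⁻¹| • (volume : Measure ℝ) := Real.map_volume_mul_left ha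
  rw [h', lintegral_smul_measure, smul_eq_mul] at h
  exact h.symm

/-- Plancherel's theorem. -/
theorem lintegral_ft_sq {f : ℝ → ℂ} (hf : Integrable f) (hf2 : MemLp f 2) :
    ∫⁻ τ, ‖ft f τ‖ₑ ^ 2 = ENNReal.ofReal (2 * π) * ∫⁻ t, ‖f t‖ₑ ^ 2 := by
  have hπ := Real.pi_pos
  simp only [ft_eq_fourier]
  rw [lintegral_comp_mul_left (-(2 * π)⁻¹) (by simp [hπ.ne']) (fun x => ‖𝓕 f x‖ₑ ^ 2),
    lintegral_fourier_sq hf hf2]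
  congr 2
  rw [inv_neg, inv_inv, abs_neg, abs_of_pos (by positivity)]

theorem Lp_integral_fourier_mul_schwartz (F : Lp ℂ 2 (volume : Measure ℝ)) (φ : 𝓢(ℝ, ℂ)) :
    ∫ x, F x * (𝓕 (φ.toLp 2 volume) : Lp ℂ 2 (volume : Measure ℝ)) x
      = ∫ x, (𝓕 F : Lp ℂ 2 (volume : Measure ℝ)) x * (φ.toLp 2 volume) x := by
  have h1 := DFunLike.congr_fun (Lp.fourier_toTemperedDistribution_eq F) φ
  rw [TemperedDistribution.fourier_apply, Lp.toTemperedDistribution_apply,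
    Lp.toTemperedDistribution_apply] at h1
  rw [SchwartzMap.toLp_fourier_eq]
  have h2 : ∫ x, F x * ((𝓕 φ).toLp 2 volume) x = ∫ x, (𝓕 φ) x • F x := by
    refine integral_congr_ae ?_
    filter_upwards [(𝓕 φ).coeFn_toLp 2 volume] with x hx
    rw [hx, smul_eq_mul, mul_comm]
  have h3 : ∫ x, (𝓕 F : Lp ℂ 2 (volume : Measure ℝ)) x * (φ.toLp 2 volume) x
      = ∫ x, φ x • (𝓕 F : Lp ℂ 2 (volume : Measure ℝ)) x := by
    refine integral_congr_ae ?_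
    filter_upwards [φ.coeFn_toLp 2 volume] with x hx
    rw [hx, smul_eq_mul, mul_comm]
  rw [h2, h3, h1]

/-- Both sides are continuous in `H`, and Schwartz functions are dense in `L²`. -/
theorem Lp_integral_fourier_mul (F H : Lp ℂ 2 (volume : Measure ℝ)) :
    ∫ x, F x * (𝓕 H : Lp ℂ 2 (volume : Measure ℝ)) x
      = ∫ x, (𝓕 F : Lp ℂ 2 (volume : Measure ℝ)) x * H x := by
  let B := (ContinuousLinearMap.mul ℂ ℂ).lpPairing (volume : Measure ℝ) 2 2
  have hB : ∀ F H : Lp ℂ 2 (volume : Measure ℝ), B F H = ∫ x, F x * H x := fun F H => by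
    simp [B, ContinuousLinearMap.lpPairing_eq_integral]
  rw [← hB, ← hB]
  have hc1 : Continuous fun H : Lp ℂ 2 (volume : Measure ℝ) =>
      B F (𝓕 H : Lp ℂ 2 (volume : Measure ℝ)) :=
    (B F).continuous.comp ContinuousFourier.continuous_fourier
  have hc2 : Continuous fun H : Lp ℂ 2 (volume : Measure ℝ) =>
      B (𝓕 F : Lp ℂ 2 (volume : Measure ℝ)) H := (B _).continuous
  refine congrFun (DenseRange.equalizer (f := SchwartzMap.toLpCLM ℂ (E := ℝ) ℂ 2 volume)
    (SchwartzMap.denseRange_toLpCLM ENNReal.ofNat_ne_top) hc1 hc2 ?_) H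
  funext φ
  simp only [Function.comp_apply, hB]
  exact Lp_integral_fourier_mul_schwartz F φ

/-- The inverse Fourier transform of an `L²` function, characterized by duality. -/
theorem exists_inverse_ft {g : ℝ → ℂ} (hg : MemLp g 2) :
    ∃ v : ℝ → ℂ, MemLp v 2 ∧ ∀ ψ : ℝ → ℂ, Integrable ψ → MemLp ψ 2 →
      ∫ τ, g τ * ft ψ τ = 2 * π * ∫ t, v t * ψ t := by
  have hπ := Real.pi_pos
  have hne : -(2 * π) ≠ 0 := by simp [hπ.ne']
  -- The substitution `τ = -2πx` turns `ft` into the normalized transform `𝓕`; its Jacobian gives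
  -- the factor `2π`.
  have hg' : MemLp (fun x => g (-(2 * π) * x)) 2 := by
    have hm : Measure.map (fun x => -(2 * π) * x) volume
      = ENNReal.ofReal |(-(2 * π))⁻¹| • (volume : Measure ℝ) := Real.map_volume_mul_left hne
    refine MemLp.comp_of_map (f := fun x => -(2 * π) * x) ?_ (by fun_prop)
    rw [hm]
    exact hg.smul_measure ENNReal.ofReal_ne_top
  refine ⟨_, Lp.memLp (𝓕 (hg'.toLp _) : Lp ℂ 2 (volume : Measure ℝ)), fun ψ hψ hψ2 => ?_⟩
  have h3 := Lp_integral_fourier_mul (hg'.toLp _) (hψ2.toLp _)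
  have h4 : ∫ x, g (-(2 * π) * x) * 𝓕 ψ x
      = ∫ x, (𝓕 (hg'.toLp _) : Lp ℂ 2 (volume : Measure ℝ)) x * ψ x := by
    rw [show ∫ x, (𝓕 (hg'.toLp _) : Lp ℂ 2 (volume : Measure ℝ)) x * ψ x
      = ∫ x, (𝓕 (hg'.toLp _) : Lp ℂ 2 (volume : Measure ℝ)) x * (hψ2.toLp _) x from ?_, ← h3]
    · refine integral_congr_ae ?_
      filter_upwards [Lp_fourier_ae_eq hψ hψ2, hg'.coeFn_toLp] with x hx hx'
      rw [hx, hx']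
    · refine integral_congr_ae ?_
      filter_upwards [hψ2.coeFn_toLp] with x hx
      rw [hx]
  rw [← h4]
  have h5 := Measure.integral_comp_mul_left (fun τ => g τ * ft ψ τ) (-(2 * π))
  have h6 : ∀ x : ℝ, -(2 * π)⁻¹ * (-(2 * π) * x) = x := fun x => by field_simp
  simp only [ft_eq_fourier, h6] at h5
  rw [h5]
  simp only [ft_eq_fourier, inv_neg, abs_neg, abs_of_pos (by positivity : 0 < (2 * π)⁻¹)]
  rw [Complex.real_smul, ← mul_assoc]
  push_cast
  rw [mul_inv_cancel₀ (by exact_mod_cast (by positivity : (2 * π : ℝ) ≠ 0)), one_mul]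

theorem continuous_ft {α : ℝ → ℂ} (hα : Integrable α) : Continuous (ft α) := by
  rw [ft_eq_fourier_fun]
  exact (VectorFourier.fourierIntegral_continuous (L := innerₗ ℝ) Real.continuous_fourierChar
    (by fun_prop) hα).comp (by fun_prop)

theorem ft_decay {α : ℝ → ℂ} (hα : ContDiff ℝ ∞ α) (hc : HasCompactSupport α) (N : ℕ) :
    ∃ C : ℝ, 0 ≤ C ∧ ∀ τ, (1 + |τ|) ^ N * ‖ft α τ‖ ≤ C := by
  have hπ := Real.pi_pos
  set φ := hc.toSchwartzMap hα
  obtain ⟨C, hC⟩ : ∃ C, ∀ x, (1 + ‖x‖) ^ N * ‖(𝓕 φ) x‖ ≤ C := ⟨_, fun x => by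
    simpa using SchwartzMap.one_add_le_sup_seminorm_apply (𝕜 := ℝ) (m := (N, 0)) le_rfl le_rfl
      (𝓕 φ) x⟩
  have hC' : ∀ τ, (1 + |τ|) ^ N * ‖ft α τ‖ ≤ (2 * π) ^ N * C := fun τ => by
    have h := hC (-(2 * π)⁻¹ * τ)
    rw [ft_eq_fourier]
    have h1 : 1 + |τ| ≤ 2 * π * (1 + ‖-(2 * π)⁻¹ * τ‖) := by
      rw [Real.norm_eq_abs, abs_mul, abs_neg, abs_of_pos (by positivity : 0 < (2 * π)⁻¹), mul_add,
        ← mul_assoc, mul_inv_cancel₀ (by positivity)]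
      linarith [Real.two_le_pi]
    calc _ ≤ (2 * π * (1 + ‖-(2 * π)⁻¹ * τ‖)) ^ N * ‖𝓕 α (-(2 * π)⁻¹ * τ)‖ := by gcongr
      _ = (2 * π) ^ N * ((1 + ‖-(2 * π)⁻¹ * τ‖) ^ N * ‖(𝓕 φ) (-(2 * π)⁻¹ * τ)‖) := by
        rw [mul_pow, mul_assoc]; rfl
      _ ≤ _ := by gcongr
  exact ⟨_, le_trans (by positivity) (hC' 0), hC'⟩

theorem ft_deriv {α : ℝ → ℂ} (hα : ContDiff ℝ ∞ α) (hc : HasCompactSupport α) (τ : ℝ) :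
    ft (deriv α) τ = -(Complex.I * τ) * ft α τ := by
  have hd : Continuous (deriv α) := hα.continuous_deriv (by norm_cast)
  rw [ft_eq_fourier, ft_eq_fourier, Real.fourier_deriv
    (hα.continuous.integrable_of_hasCompactSupport hc) (hα.differentiable (by norm_cast))
    (hd.integrable_of_hasCompactSupport hc.deriv)]
  simp only [smul_eq_mul]
  congr 1
  have : (π : ℂ) ≠ 0 := by exact_mod_cast Real.pi_ne_zero
  push_cast
  field_simp

theorem ft_integrand_integrable {α : ℝ → ℂ} (hα : Integrable α) (τ : ℝ) :
    Integrable fun t : ℝ => α t * Complex.exp (Complex.I * (τ * t)) := by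
  refine hα.mul_bdd (c := 1) (by fun_prop) (.of_forall fun t => ?_)
  rw [show Complex.I * (τ * t) = ((τ * t : ℝ) : ℂ) * Complex.I by push_cast; ring,
    Complex.norm_exp_ofReal_mul_I]

theorem ft_add {α β : ℝ → ℂ} (hα : Integrable α) (hβ : Integrable β) (τ : ℝ) :
    ft (fun t => α t + β t) τ = ft α τ + ft β τ := by
  simp only [ft, add_mul]
  exact integral_add (ft_integrand_integrable hα τ) (ft_integrand_integrable hβ τ)

theorem ft_const_mul (c : ℂ) (α : ℝ → ℂ) (τ : ℝ) :
    ft (fun t => c * α t) τ = c * ft α τ := by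
  simp only [ft, mul_assoc]
  exact integral_const_mul _ _

theorem ft_mul_exp (α : ℝ → ℂ) (η τ : ℝ) :
    ft (fun t => α t * Complex.exp (Complex.I * (η * t))) τ = ft α (τ + η) := by
  simp only [ft, mul_assoc, ← Complex.exp_add]
  refine integral_congr_ae (.of_forall fun t => ?_)
  simp only
  congr 2
  push_cast
  ring

end

/-! ### Weights, the frequency gain, and convolution inequalities. -/

noncomputable section

theorem one_le_bracket (x : ℝ) : 1 ≤ bracket x :=
  Real.one_le_sqrt.2 (by nlinarith [sq_nonneg x])

theorem bracket_pos (x : ℝ) : 0 < bracket x := zero_lt_one.trans_le (one_le_bracket x)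

theorem bracket_sq (x : ℝ) : bracket x ^ 2 = 1 + x ^ 2 := Real.sq_sqrt (by positivity)

theorem bracket_le_one_add_abs (x : ℝ) : bracket x ≤ 1 + |x| := by
  refine abs_le_of_sq_le_sq' ?_ (by positivity) |>.2
  rw [bracket_sq, add_sq, sq_abs]
  nlinarith [abs_nonneg x]

theorem abs_le_bracket (x : ℝ) : |x| ≤ bracket x :=
  Real.abs_le_sqrt (by linarith)

/-- Lagrange's identity: `(1 + x²)(1 + y²) - (x - y)² = (1 + xy)²`. -/
theorem abs_sub_le_bracket_mul (x y : ℝ) : |x - y| ≤ bracket x * bracket y := by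
  refine abs_le_of_sq_le_sq ?_ (mul_nonneg (bracket_pos x).le (bracket_pos y).le)
  rw [mul_pow, bracket_sq, bracket_sq]
  nlinarith [sq_nonneg (1 + x * y)]

/-- Peetre's inequality. -/
theorem bracket_le_mul (x y : ℝ) : bracket x ≤ bracket y * (1 + |x - y|) := by
  have hy := one_le_bracket y
  have h1 : bracket x ≤ bracket y + |x - y| := by
    refine abs_le_of_sq_le_sq' ?_ (by positivity) |>.2
    rw [add_sq, bracket_sq, bracket_sq, sq_abs]
    have h2 : y * (x - y) ≤ bracket y * |x - y| := (le_abs_self _).trans (by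
      rw [abs_mul]; exact mul_le_mul_of_nonneg_right (abs_le_bracket y) (abs_nonneg _))
    nlinarith
  nlinarith [abs_nonneg (x - y)]

theorem continuous_bracket : Continuous bracket := by
  unfold bracket; fun_prop

theorem one_le_freq (k : ℤ) : 1 ≤ freq k := by
  unfold freq
  split_ifs with h
  · exact le_rfl
  · exact_mod_cast Int.one_le_abs h

theorem freq_pos (k : ℤ) : 0 < freq k := zero_lt_one.trans_le (one_le_freq k)

theorem freq_le_one_add_abs_mul (n k : ℤ) : freq n ≤ freq k * (1 + |((k - n : ℤ) : ℝ)|) := by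
  have hk := one_le_freq k
  have h1 : |(k : ℝ)| ≤ freq k := by
    unfold freq; split_ifs with h <;> simp [h]
  have h2 : |(n : ℝ)| ≤ |(k : ℝ)| + |((k - n : ℤ) : ℝ)| := by
    push_cast
    have := abs_sub_abs_le_abs_sub (n : ℝ) k
    rw [abs_sub_comm] at this
    linarith
  have h3 := abs_nonneg ((k - n : ℤ) : ℝ)
  have h4 : freq n ≤ 1 ∨ freq n ≤ |(n : ℝ)| := by
    unfold freq; split_ifs with h <;> simp
  rcases h4 with h4 | h4 <;> nlinarith

/-- Peetre's inequality for frequencies; a negative exponent is handled by exchanging `n` and `k`.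
-/
theorem freq_rpow_le (s : ℝ) (n k : ℤ) :
    freq n ^ s ≤ freq k ^ s * (1 + |((k - n : ℤ) : ℝ)|) ^ |s| := by
  have hn := freq_pos n
  have hk := freq_pos k
  have hd : 0 < 1 + |((k - n : ℤ) : ℝ)| := by positivity
  rcases le_total 0 s with hs | hs
  · rw [abs_of_nonneg hs, ← Real.mul_rpow hk.le hd.le]
    exact Real.rpow_le_rpow hn.le (freq_le_one_add_abs_mul n k) hs
  · rw [abs_of_nonpos hs, Real.rpow_neg hd.le, ← div_eq_mul_inv,
      le_div_iff₀ (Real.rpow_pos_of_pos hd _), ← Real.mul_rpow hn.le hd.le]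
    refine Real.rpow_le_rpow_of_nonpos hk ?_ hs
    have := freq_le_one_add_abs_mul k n
    rwa [show ((n - k : ℤ) : ℝ) = -((k - n : ℤ) : ℝ) by push_cast; ring, abs_neg] at this

/-- The factors `n + k` and `n - k` are nonzero integers with sum `2n`, and `a + c ≤ 2ac` whenever
`a, c ≥ 1`. -/
theorem abs_le_abs_sq_sub_sq {n k : ℤ} (h : n ^ 2 ≠ k ^ 2) : |n| ≤ |n ^ 2 - k ^ 2| := by
  rw [sq_sub_sq, abs_mul]
  have h1 : 1 ≤ |n + k| := Int.one_le_abs fun h0 => h (by rw [eq_neg_of_add_eq_zero_left h0]; ring)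
  have h2 : 1 ≤ |n - k| := Int.one_le_abs fun h0 => h (by rw [sub_eq_zero.1 h0])
  have h3 : |2 * n| ≤ |n + k| + |n - k| := by
    have := abs_add_le (n + k) (n - k)
    rwa [show n + k + (n - k) = 2 * n by ring] at this
  rw [abs_mul] at h3
  norm_num at h3
  nlinarith

theorem freq_le_abs_sq_sub_sq {n k : ℤ} (h : n ^ 2 ≠ k ^ 2) :
    freq n ≤ |(n : ℝ) ^ 2 - (k : ℝ) ^ 2| := by
  have h1 : 1 ≤ |n ^ 2 - k ^ 2| := Int.one_le_abs (sub_ne_zero.2 h)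
  have h2 := abs_le_abs_sq_sub_sq h
  unfold freq
  split_ifs
  · exact_mod_cast h1
  · exact_mod_cast h2

/-- The gain from time oscillation between two distinct frequencies. -/
theorem freq_mul_freq_le {n k : ℤ} (h : n ≠ k) (τ : ℝ) :
    freq n * freq k ≤ (bracket (τ + (n : ℝ) ^ 2) * bracket (τ + (k : ℝ) ^ 2) *
      (1 + |((k - n : ℤ) : ℝ)|)) ^ 2 := by
  set B := bracket (τ + (n : ℝ) ^ 2) * bracket (τ + (k : ℝ) ^ 2) with hB
  have hB1 : 1 ≤ B := one_le_mul_of_one_le_of_one_le (one_le_bracket _) (one_le_bracket _)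
  have hd := abs_nonneg ((k - n : ℤ) : ℝ)
  set d := |((k - n : ℤ) : ℝ)| with hd'
  have key : freq n ≤ B * (1 + d) ∧ freq k ≤ B * (1 + d) := by
    -- In the resonant case `k = -n` the brackets gain nothing, but the distance between the
    -- frequencies is `2|k|`. Otherwise `|n² - k²|` is bounded by the product of the brackets.
    by_cases hnk : n ^ 2 = k ^ 2
    · rcases sq_eq_sq_iff_eq_or_eq_neg.1 hnk with h1 | h1
      · exact absurd h1 h
      · have hk0 : k ≠ 0 := fun h0 => h (by simp [h1, h0])
        have h3 : d = 2 * |(k : ℝ)| := by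
          rw [hd', h1]; push_cast; rw [show (k : ℝ) - -k = 2 * k by ring, abs_mul]; norm_num
        have h2 : freq n = |(k : ℝ)| := by
          unfold freq; rw [if_neg (by omega), h1]; push_cast; exact abs_neg _
        have h4 : freq k = |(k : ℝ)| := if_neg hk0
        rw [h2, h4, h3]
        have := abs_nonneg (k : ℝ)
        constructor <;> nlinarith
    · have h1 := abs_sub_le_bracket_mul (τ + (n : ℝ) ^ 2) (τ + (k : ℝ) ^ 2)
      rw [show τ + (n : ℝ) ^ 2 - (τ + (k : ℝ) ^ 2) = (n : ℝ) ^ 2 - (k : ℝ) ^ 2 by ring, ← hB] at h1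
      have h2 := freq_le_abs_sq_sub_sq hnk
      have h3 := freq_le_abs_sq_sub_sq (Ne.symm hnk)
      rw [abs_sub_comm] at h3
      constructor <;> nlinarith
  rw [sq]
  exact mul_le_mul key.1 key.2 (freq_pos _).le (by positivity)

/-- Half of the weight `freq n ^ (2 * s)` is moved to `k` by Peetre; the excess `σ/2` over `r` at
each frequency is then paid by the power `σ/2` of `freq_mul_freq_le`. Powers of the distance are
harmless, since they will meet rapidly decreasing coefficients. -/
theorem freq_rpow_two_mul_le {σ s r : ℝ} (hσ0 : 0 ≤ σ) (hσ1 : σ ≤ 1) (hs : s ≤ r + σ / 2)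
    {n k : ℤ} (h : n ≠ k) (τ : ℝ) :
    freq n ^ (2 * s) ≤ (1 + |((k - n : ℤ) : ℝ)|) ^ (2 * ⌈|s|⌉₊ + 1) *
      ((freq n ^ r * bracket (τ + (n : ℝ) ^ 2) ^ σ) *
        (freq k ^ r * bracket (τ + (k : ℝ) ^ 2) ^ σ)) := by
  have hn := one_le_freq n
  have hk := one_le_freq k
  have hn0 := freq_pos n
  have hk0 := freq_pos k
  have hbn := bracket_pos (τ + (n : ℝ) ^ 2)
  have hbk := bracket_pos (τ + (k : ℝ) ^ 2)
  set d := 1 + |((k - n : ℤ) : ℝ)| with hd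
  have hd1 : 1 ≤ d := by rw [hd]; linarith [abs_nonneg ((k - n : ℤ) : ℝ)]
  have hd0 : 0 < d := by linarith
  have h1 : freq n ^ s ≤ freq k ^ s * d ^ ⌈|s|⌉₊ := (freq_rpow_le s n k).trans (by
    rw [← Real.rpow_natCast]
    gcongr
    exact Nat.le_ceil _)
  have h2 : ∀ m : ℤ, freq m ^ s ≤ freq m ^ r * freq m ^ (σ / 2) := fun m => by
    rw [← Real.rpow_add (freq_pos m)]
    exact Real.rpow_le_rpow_of_exponent_le (one_le_freq m) hs
  have h3 : freq n ^ (σ / 2) * freq k ^ (σ / 2) ≤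
      bracket (τ + (n : ℝ) ^ 2) ^ σ * bracket (τ + (k : ℝ) ^ 2) ^ σ * d := by
    rw [← Real.mul_rpow hn0.le hk0.le, ← Real.mul_rpow hbn.le hbk.le]
    calc _ ≤ ((bracket (τ + (n : ℝ) ^ 2) * bracket (τ + (k : ℝ) ^ 2) * d) ^ 2) ^ (σ / 2) :=
          Real.rpow_le_rpow (by positivity) (freq_mul_freq_le h τ) (by linarith)
      _ = (bracket (τ + (n : ℝ) ^ 2) * bracket (τ + (k : ℝ) ^ 2)) ^ σ * d ^ σ := by
          rw [← Real.rpow_natCast, ← Real.rpow_mul (by positivity),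
            ← Real.mul_rpow (by positivity) hd0.le]
          congr 1; push_cast; ring
      _ ≤ _ := by
          gcongr
          calc d ^ σ ≤ d ^ (1 : ℝ) := Real.rpow_le_rpow_of_exponent_le hd1 hσ1
            _ = d := Real.rpow_one d
  calc freq n ^ (2 * s) = freq n ^ s * freq n ^ s := by
        rw [← Real.rpow_add hn0]; ring_nf
    _ ≤ (freq n ^ r * freq n ^ (σ / 2)) * ((freq k ^ r * freq k ^ (σ / 2)) * d ^ ⌈|s|⌉₊) := by
        gcongr
        · exact h2 n
        · exact h1.trans (by gcongr; exact h2 k)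
    _ = freq n ^ r * freq k ^ r * d ^ ⌈|s|⌉₊ * (freq n ^ (σ / 2) * freq k ^ (σ / 2)) := by ring
    _ ≤ freq n ^ r * freq k ^ r * d ^ ⌈|s|⌉₊ * (bracket (τ + (n : ℝ) ^ 2) ^ σ *
          bracket (τ + (k : ℝ) ^ 2) ^ σ * d) := by gcongr
    _ = d ^ (⌈|s|⌉₊ + 1) * ((freq n ^ r * bracket (τ + (n : ℝ) ^ 2) ^ σ) *
          (freq k ^ r * bracket (τ + (k : ℝ) ^ 2) ^ σ)) := by ring
    _ ≤ _ := by
        gcongr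
        omega

/-- Cauchy–Schwarz with a weight. -/
theorem lintegral_mul_sq_le {X : Type*} [MeasurableSpace X] {μ : Measure X} {f w : X → ℝ≥0∞}
    (hf : AEMeasurable f μ) (hw : AEMeasurable w μ) :
    (∫⁻ x, f x * w x ∂μ) ^ 2 ≤ (∫⁻ x, w x ∂μ) * ∫⁻ x, f x ^ 2 * w x ∂μ := by
  have hsq : ∀ a : ℝ≥0∞, (a ^ (1 / 2 : ℝ)) ^ 2 = a := fun a => by
    rw [← ENNReal.rpow_natCast, ← ENNReal.rpow_mul]; norm_num
  have h := ENNReal.lintegral_mul_le_Lp_mul_Lq μ (p := 2) (q := 2) .two_two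
    (f := fun x => f x * w x ^ (1 / 2 : ℝ)) (g := fun x => w x ^ (1 / 2 : ℝ))
    (hf.mul (hw.pow_const _)) (hw.pow_const _)
  simp only [Pi.mul_apply, mul_assoc, ← sq, hsq, ENNReal.rpow_two] at h
  calc _ ≤ _ := pow_le_pow_left' h 2
    _ = _ := by
      rw [mul_pow, hsq, hsq, mul_comm]
      simp only [mul_pow, hsq]

theorem tsum_mul_sq_le (f w : ℤ → ℝ≥0∞) :
    (∑' k, f k * w k) ^ 2 ≤ (∑' k, w k) * ∑' k, f k ^ 2 * w k := by
  have h := lintegral_mul_sq_le (μ := Measure.count) (f := f) (w := w)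
    (measurable_of_countable _).aemeasurable (measurable_of_countable _).aemeasurable
  simpa only [lintegral_count] using h

/-- Young's inequality `L¹ * L² ⊆ L²`. -/
theorem lintegral_conv_sq_le {h K : ℝ → ℝ≥0∞} (hh : AEMeasurable h) (hK : Measurable K) :
    ∫⁻ η, (∫⁻ τ, h τ * K (τ - η)) ^ 2 ≤ (∫⁻ x, K x) ^ 2 * ∫⁻ τ, h τ ^ 2 := by
  wlog hm : Measurable h generalizing h
  · have e : h =ᵐ[volume] hh.mk h := hh.ae_eq_mk
    have := this hh.measurable_mk.aemeasurable hh.measurable_mk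
    convert! this using 1
    · refine lintegral_congr fun η => ?_
      congr 1
      exact lintegral_congr_ae (by filter_upwards [e] with x hx; rw [hx])
    · congr 1
      exact lintegral_congr_ae (by filter_upwards [e] with x hx; rw [hx])
  calc ∫⁻ η, (∫⁻ τ, h τ * K (τ - η)) ^ 2
      ≤ ∫⁻ η, (∫⁻ x, K x) * ∫⁻ τ, h τ ^ 2 * K (τ - η) := by
        refine lintegral_mono fun η => ?_
        refine (lintegral_mul_sq_le hm.aemeasurable
          (hK.comp (measurable_id.sub_const η)).aemeasurable).trans_eq ?_
        simp only [Function.comp_def, id]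
        rw [lintegral_sub_right_eq_self (fun x => K x) η]
    _ = (∫⁻ x, K x) * ∫⁻ η, ∫⁻ τ, h τ ^ 2 * K (τ - η) := by
        refine lintegral_const_mul _ ?_
        exact Measurable.lintegral_prod_right' (f := fun p : ℝ × ℝ => h p.2 ^ 2 * K (p.2 - p.1))
          (by fun_prop)
    _ = (∫⁻ x, K x) * ∫⁻ τ, ∫⁻ η, h τ ^ 2 * K (τ - η) := by
        rw [lintegral_lintegral_swap]
        exact Measurable.aemeasurable
          (f := fun p : ℝ × ℝ => h p.2 ^ 2 * K (p.2 - p.1)) (by fun_prop)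
    _ = (∫⁻ x, K x) * ∫⁻ τ, h τ ^ 2 * ∫⁻ x, K x := by
        congr 1
        refine lintegral_congr fun τ => ?_
        rw [lintegral_const_mul _ (by fun_prop), lintegral_sub_left_eq_self (fun x => K x) τ]
    _ = _ := by
        rw [lintegral_mul_const _ (by fun_prop)]
        ring

theorem ENNReal_add_sq_le (a b : ℝ≥0∞) : (a + b) ^ 2 ≤ 4 * (a ^ 2 + b ^ 2) := by
  rcases le_total a b with h | h
  · calc (a + b) ^ 2 ≤ (b + b) ^ 2 := by gcongr
      _ = 4 * b ^ 2 := by ring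
      _ ≤ _ := by gcongr; exact le_add_self
  · calc (a + b) ^ 2 ≤ (a + a) ^ 2 := by gcongr
      _ = 4 * a ^ 2 := by ring
      _ ≤ _ := by gcongr; exact le_self_add

theorem ofReal_rpow_two_mul {x : ℝ} (hx : 0 < x) (a : ℝ) :
    ENNReal.ofReal (x ^ (2 * a)) = ENNReal.ofReal (x ^ a) ^ 2 := by
  rw [← ENNReal.ofReal_pow (Real.rpow_nonneg hx.le _), ← Real.rpow_natCast, ← Real.rpow_mul hx.le]
  congr 2; push_cast; ring

/-- Localization in time of a function whose Schrödinger operator is controlled, at a single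
frequency. -/
theorem lintegral_bracket_conv_le {b m : ℝ} (hb0 : 0 ≤ b) (hb1 : b ≤ 1)
    {gu gf : ℝ → ℂ} (hgu : AEStronglyMeasurable gu volume) (hgf : AEStronglyMeasurable gf volume)
    {G : ℝ → ℂ} {K : ℝ → ℝ≥0∞} (hK : Measurable K)
    (hG : ∀ η, ENNReal.ofReal (bracket (η + m)) * ‖G η‖ₑ ≤
      ∫⁻ τ, (‖gu τ‖ₑ + ‖gf τ‖ₑ) * K (τ - η)) :
    ∫⁻ τ, ENNReal.ofReal (bracket (τ + m) ^ (2 * (1 - b))) * ‖G τ‖ₑ ^ 2 ≤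
      4 * (∫⁻ x, ENNReal.ofReal (1 + |x|) * K x) ^ 2 *
      ((∫⁻ τ, ENNReal.ofReal (bracket (τ + m) ^ (2 * b)) * ‖gu τ‖ₑ ^ 2) +
        ∫⁻ τ, ENNReal.ofReal (bracket (τ + m) ^ (2 * (-b))) * ‖gf τ‖ₑ ^ 2) := by
  set W : ℝ → ℝ≥0∞ := fun τ => ENNReal.ofReal (bracket (τ + m) ^ (-b)) with hW
  have hWc : Measurable W := by
    refine ENNReal.measurable_ofReal.comp ?_
    exact ((continuous_bracket.measurable.comp (measurable_id.add_const m)).pow_const _)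
  -- Peetre costs the power `b` of `1 + |τ - η|`, and `b ≤ 1` lets one full power serve.
  have hshift : ∀ τ η, W η ≤ W τ * ENNReal.ofReal (1 + |τ - η|) := fun τ η => by
    rw [hW, ← ENNReal.ofReal_mul (Real.rpow_nonneg (bracket_pos _).le _)]
    refine ENNReal.ofReal_le_ofReal ?_
    have h1 := bracket_le_mul (τ + m) (η + m)
    rw [show τ + m - (η + m) = τ - η by ring] at h1
    have hd : (1 : ℝ) ≤ 1 + |τ - η| := by linarith [abs_nonneg (τ - η)]
    have hp := bracket_pos (τ + m)
    have hq := bracket_pos (η + m)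
    rw [Real.rpow_neg hp.le, Real.rpow_neg hq.le, inv_mul_eq_div,
      le_div_iff₀ (Real.rpow_pos_of_pos hp _), inv_mul_le_iff₀ (Real.rpow_pos_of_pos hq _)]
    calc bracket (τ + m) ^ b ≤ (bracket (η + m) * (1 + |τ - η|)) ^ b :=
          Real.rpow_le_rpow hp.le h1 hb0
      _ = bracket (η + m) ^ b * (1 + |τ - η|) ^ b := Real.mul_rpow hq.le (by linarith)
      _ ≤ bracket (η + m) ^ b * (1 + |τ - η|) ^ (1 : ℝ) := by
          gcongr
      _ = _ := by rw [Real.rpow_one]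
  have hpt : ∀ η, ENNReal.ofReal (bracket (η + m) ^ (1 - b)) * ‖G η‖ₑ ≤
      ∫⁻ τ, (W τ * (‖gu τ‖ₑ + ‖gf τ‖ₑ)) *
        ((fun x => ENNReal.ofReal (1 + |x|) * K x) (τ - η)) := fun η => by
    have hq := bracket_pos (η + m)
    calc ENNReal.ofReal (bracket (η + m) ^ (1 - b)) * ‖G η‖ₑ
        = W η * (ENNReal.ofReal (bracket (η + m)) * ‖G η‖ₑ) := by
          rw [← mul_assoc, hW, ← ENNReal.ofReal_mul (Real.rpow_nonneg hq.le _),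
            show 1 - b = -b + 1 by ring, Real.rpow_add hq, Real.rpow_one]
      _ ≤ W η * ∫⁻ τ, (‖gu τ‖ₑ + ‖gf τ‖ₑ) * K (τ - η) := by gcongr; exact hG η
      _ ≤ ∫⁻ τ, W η * ((‖gu τ‖ₑ + ‖gf τ‖ₑ) * K (τ - η)) := lintegral_const_mul_le _ _
      _ ≤ _ := by
          refine lintegral_mono fun τ => ?_
          calc _ ≤ W τ * ENNReal.ofReal (1 + |τ - η|) * ((‖gu τ‖ₑ + ‖gf τ‖ₑ) * K (τ - η)) := by
                gcongr; exact hshift τ η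
            _ = _ := by ring
  calc ∫⁻ τ, ENNReal.ofReal (bracket (τ + m) ^ (2 * (1 - b))) * ‖G τ‖ₑ ^ 2
      = ∫⁻ τ, (ENNReal.ofReal (bracket (τ + m) ^ (1 - b)) * ‖G τ‖ₑ) ^ 2 := by
        refine lintegral_congr fun τ => ?_
        rw [mul_pow, ofReal_rpow_two_mul (bracket_pos _)]
    _ ≤ ∫⁻ η, (∫⁻ τ, (W τ * (‖gu τ‖ₑ + ‖gf τ‖ₑ)) *
        ((fun x => ENNReal.ofReal (1 + |x|) * K x) (τ - η))) ^ 2 :=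
        lintegral_mono fun η => pow_le_pow_left' (hpt η) 2
    _ ≤ (∫⁻ x, ENNReal.ofReal (1 + |x|) * K x) ^ 2 *
          ∫⁻ τ, (W τ * (‖gu τ‖ₑ + ‖gf τ‖ₑ)) ^ 2 :=
        lintegral_conv_sq_le (hWc.aemeasurable.mul (hgu.enorm.add hgf.enorm)) (by fun_prop)
    _ ≤ (∫⁻ x, ENNReal.ofReal (1 + |x|) * K x) ^ 2 *
          ∫⁻ τ, 4 * (ENNReal.ofReal (bracket (τ + m) ^ (2 * b)) * ‖gu τ‖ₑ ^ 2 +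
            ENNReal.ofReal (bracket (τ + m) ^ (2 * (-b))) * ‖gf τ‖ₑ ^ 2) := by
        gcongr with τ
        -- Since `b ≥ 0`, the function `gu` is a fortiori in the weaker space of `gf`.
        have h2 : ENNReal.ofReal (bracket (τ + m) ^ (2 * (-b))) ≤
            ENNReal.ofReal (bracket (τ + m) ^ (2 * b)) :=
          ENNReal.ofReal_le_ofReal
            (Real.rpow_le_rpow_of_exponent_le (one_le_bracket _) (by linarith))
        calc (W τ * (‖gu τ‖ₑ + ‖gf τ‖ₑ)) ^ 2
            ≤ W τ ^ 2 * (4 * (‖gu τ‖ₑ ^ 2 + ‖gf τ‖ₑ ^ 2)) := by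
              rw [mul_pow]; gcongr; exact ENNReal_add_sq_le _ _
          _ = 4 * (ENNReal.ofReal (bracket (τ + m) ^ (2 * (-b))) * ‖gu τ‖ₑ ^ 2 +
            ENNReal.ofReal (bracket (τ + m) ^ (2 * (-b))) * ‖gf τ‖ₑ ^ 2) := by
              rw [ofReal_rpow_two_mul (bracket_pos _)]; ring
          _ ≤ _ := by gcongr
    _ = _ := by
        rw [lintegral_const_mul' _ _ (by norm_num), lintegral_add_right']
        · ring
        · refine AEMeasurable.mul (Measurable.aemeasurable ?_) (hgf.enorm.pow_const _)
          refine ENNReal.measurable_ofReal.comp ?_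
          exact ((continuous_bracket.measurable.comp (measurable_id.add_const m)).pow_const _)

end

/-! ### The `ℓ²` estimate that propagates regularity. -/

noncomputable section

theorem ENNReal_two_mul_le_add_sq {a b : ℝ≥0∞} (ha : a ≠ ∞) (hb : b ≠ ∞) :
    2 * (a * b) ≤ a ^ 2 + b ^ 2 := by
  lift a to NNReal using ha
  lift b to NNReal using hb
  have := two_mul_le_add_sq (a : ℝ) b
  rw [mul_assoc] at this
  exact_mod_cast this

/-- Multiply by `a` and absorb half of the `a * f` term. The remainder must stay in the form `a * ρ`
rather than `ρ ^ 2`: the gain exists only for products of coefficients at distinct frequencies. -/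
theorem sq_le_of_le_add {a f ρ : ℝ≥0∞} (ha : a ≠ ∞) (hf : f ≠ ∞) (h : a ≤ f + ρ) :
    a ^ 2 ≤ f ^ 2 + 2 * (a * ρ) := by
  have h1 : a ^ 2 + a ^ 2 ≤ a ^ 2 + (f ^ 2 + 2 * (a * ρ)) := by
    calc a ^ 2 + a ^ 2 = 2 * (a * a) := by ring
      _ ≤ 2 * (a * (f + ρ)) := by gcongr
      _ = 2 * (a * f) + 2 * (a * ρ) := by ring
      _ ≤ (a ^ 2 + f ^ 2) + 2 * (a * ρ) := by gcongr; exact ENNReal_two_mul_le_add_sq ha hf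
      _ = _ := by ring
  exact (ENNReal.add_le_add_iff_left (by finiteness)).1 h1

theorem tsum_shift (f : ℤ → ℝ≥0∞) (n : ℤ) : ∑' k : ℤ, f (k - n) = ∑' k, f k :=
  (Equiv.subRight n).tsum_eq f

theorem tsum_shift' (f : ℤ → ℝ≥0∞) (k : ℤ) : ∑' n : ℤ, f (k - n) = ∑' n, f n :=
  (Equiv.subLeft k).tsum_eq f

/-- A coefficient sequence decreasing faster than every power. -/
def RapidDecay (p : ℤ → ℂ) : Prop :=
  ∀ N : ℕ, ∃ C : ℝ, ∀ m : ℤ, (1 + |(m : ℝ)|) ^ N * ‖p m‖ ≤ C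

theorem RapidDecay.tsum_lt_top {p : ℤ → ℂ} (hp : RapidDecay p) (N : ℕ) :
    ∑' m : ℤ, ENNReal.ofReal ((1 + |(m : ℝ)|) ^ N) * ‖p m‖ₑ < ∞ := by
  -- Two extra powers leave the summable majorant `1 / (1 + m²)`.
  obtain ⟨C, hC⟩ := hp (N + 2)
  have hC0 : 0 ≤ C := le_trans (by positivity) (hC 0)
  have hs : Summable fun m : ℤ => C * (1 + (m : ℝ) ^ 2)⁻¹ := by
    refine Summable.mul_left _ ?_
    refine Summable.of_nonneg_of_le (fun m => by positivity) (fun m => ?_)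
      (summable_of_hasFiniteSupport (f := fun m : ℤ => if m = 0 then (1 : ℝ) else 0)
        ((Set.finite_singleton 0).subset fun m hm => by
          by_contra h; simp at h; simp [h] at hm) |>.add
        (Real.summable_one_div_int_pow.2 one_lt_two))
    by_cases h : m = 0
    · simp [h]
    · have h0 : 0 < (m : ℝ) ^ 2 := by positivity
      simp only [h, if_false, zero_add, one_div]
      gcongr
      linarith
  refine lt_of_le_of_lt (ENNReal.tsum_le_tsum fun m => ?_)
    (lt_top_iff_ne_top.2 hs.tsum_ofReal_ne_top)
  rw [← ofReal_norm, ← ENNReal.ofReal_mul (by positivity)]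
  refine ENNReal.ofReal_le_ofReal ?_
  have h1 := hC m
  rw [← div_eq_mul_inv, le_div_iff₀ (by positivity)]
  refine le_trans ?_ h1
  rw [pow_add, mul_assoc, mul_assoc, mul_comm ‖p m‖]
  gcongr
  rw [add_sq, sq_abs]
  nlinarith [abs_nonneg (m : ℝ)]

/-- Convolution with a rapidly decreasing sequence preserves the weighted `ℓ²L²` spaces. -/
theorem tsum_lintegral_conv_lt_top {s : ℝ} {p : ℤ → ℂ} (hp : RapidDecay p)
    {C : ℤ → ℝ → ℂ} (hC : ∀ k, AEStronglyMeasurable (C k) volume)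
    (hCs : ∑' k, ∫⁻ τ, ENNReal.ofReal (freq k ^ (2 * s)) * ‖C k τ‖ₑ ^ 2 < ∞) :
    ∑' n, ∫⁻ τ, ENNReal.ofReal (freq n ^ (2 * s)) * (∑' k, ‖p (k - n)‖ₑ * ‖C k τ‖ₑ) ^ 2 < ∞ := by
  set A := ∑' k, ‖p k‖ₑ with hA
  set N := ⌈|2 * s|⌉₊ with hN
  set Q : ℤ → ℝ≥0∞ := fun m => ENNReal.ofReal ((1 + |(m : ℝ)|) ^ N) * ‖p m‖ₑ with hQ
  have hAtop : A < ∞ := by simpa using hp.tsum_lt_top 0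
  have hw : ∀ n k : ℤ, ENNReal.ofReal (freq n ^ (2 * s)) ≤
      ENNReal.ofReal (freq k ^ (2 * s)) * ENNReal.ofReal ((1 + |((k - n : ℤ) : ℝ)|) ^ N) := by
    intro n k
    rw [← ENNReal.ofReal_mul (Real.rpow_nonneg (freq_pos k).le _)]
    refine ENNReal.ofReal_le_ofReal ((freq_rpow_le _ n k).trans ?_)
    have hk := freq_pos k
    rw [← Real.rpow_natCast]
    gcongr
    · linarith [abs_nonneg ((k - n : ℤ) : ℝ)]
    · exact Nat.le_ceil _
  have hpt : ∀ n τ, ENNReal.ofReal (freq n ^ (2 * s)) * (∑' k, ‖p (k - n)‖ₑ * ‖C k τ‖ₑ) ^ 2 ≤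
      A * ∑' k, Q (k - n) * (ENNReal.ofReal (freq k ^ (2 * s)) * ‖C k τ‖ₑ ^ 2) := by
    intro n τ
    calc ENNReal.ofReal (freq n ^ (2 * s)) * (∑' k, ‖p (k - n)‖ₑ * ‖C k τ‖ₑ) ^ 2
        ≤ ENNReal.ofReal (freq n ^ (2 * s)) * (∑' k, ‖C k τ‖ₑ * ‖p (k - n)‖ₑ) ^ 2 := by
          simp only [mul_comm, le_refl]
      _ ≤ ENNReal.ofReal (freq n ^ (2 * s)) *
            (A * ∑' k, ‖C k τ‖ₑ ^ 2 * ‖p (k - n)‖ₑ) := by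
          gcongr
          refine (tsum_mul_sq_le _ _).trans_eq ?_
          rw [tsum_shift (fun m => ‖p m‖ₑ) n]
      _ = A * ∑' k, ENNReal.ofReal (freq n ^ (2 * s)) * (‖C k τ‖ₑ ^ 2 * ‖p (k - n)‖ₑ) := by
          rw [ENNReal.tsum_mul_left]; ring
      _ ≤ _ := by
          refine mul_le_mul' le_rfl (ENNReal.tsum_le_tsum fun k => ?_)
          calc _ ≤ (ENNReal.ofReal (freq k ^ (2 * s)) *
                ENNReal.ofReal ((1 + |((k - n : ℤ) : ℝ)|) ^ N)) *
                (‖C k τ‖ₑ ^ 2 * ‖p (k - n)‖ₑ) := mul_le_mul' (hw n k) le_rfl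
            _ = _ := by rw [hQ]; ring
  have hmeas : ∀ k, AEMeasurable
      (fun τ => ENNReal.ofReal (freq k ^ (2 * s)) * ‖C k τ‖ₑ ^ 2) volume :=
    fun k => ((hC k).enorm.pow_const _).const_mul _
  calc ∑' n, ∫⁻ τ, ENNReal.ofReal (freq n ^ (2 * s)) * (∑' k, ‖p (k - n)‖ₑ * ‖C k τ‖ₑ) ^ 2
      ≤ ∑' n, ∫⁻ τ, A * ∑' k, Q (k - n) *
          (ENNReal.ofReal (freq k ^ (2 * s)) * ‖C k τ‖ₑ ^ 2) :=
        ENNReal.tsum_le_tsum fun n => lintegral_mono (hpt n)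
    _ = ∑' n, A * ∑' k, Q (k - n) *
          ∫⁻ τ, ENNReal.ofReal (freq k ^ (2 * s)) * ‖C k τ‖ₑ ^ 2 := by
        congr 1; funext n
        rw [lintegral_const_mul' _ _ hAtop.ne, lintegral_tsum fun k => (hmeas k).const_mul _]
        congr 2; funext k
        rw [lintegral_const_mul'' _ (hmeas k)]
    _ = A * ((∑' m, Q m) * ∑' k, ∫⁻ τ, ENNReal.ofReal (freq k ^ (2 * s)) * ‖C k τ‖ₑ ^ 2) := by
        rw [ENNReal.tsum_mul_left, ENNReal.tsum_comm]
        congr 1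
        rw [← ENNReal.tsum_mul_left]
        congr 1; funext k
        rw [ENNReal.tsum_mul_right, tsum_shift' Q]
    _ < ∞ := ENNReal.mul_lt_top hAtop (ENNReal.mul_lt_top (hp.tsum_lt_top N) hCs)

/-- The core of the propagation of regularity: if `∑ G k e^{ikx}` and `∑ C k e^{ikx}`
coincide after multiplication by a function with Fourier coefficients `p (-k)`, and the latter is
in the space of order `s`, then so is the former. -/
theorem tsum_lintegral_lt_top_of_bourgain {σ s r : ℝ} (hσ0 : 0 ≤ σ) (hσ1 : σ ≤ 1)
    (hs : s ≤ r + σ / 2) {p : ℤ → ℂ} (hp : RapidDecay p) (hp0 : p 0 ≠ 0) {G C : ℤ → ℝ → ℂ}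
    (hG : ∀ k, AEStronglyMeasurable (G k) volume)
    (hGs : bourgainNormSq r σ (fun τ k => G k τ) < ∞)
    (hC : ∀ k, AEStronglyMeasurable (C k) volume)
    (hCs : ∑' k, ∫⁻ τ, ENNReal.ofReal (freq k ^ (2 * s)) * ‖C k τ‖ₑ ^ 2 < ∞)
    (hGC : ∀ n τ, HasSum (fun k => p (k - n) * (G k τ - C k τ)) 0) :
    ∑' n, ∫⁻ τ, ENNReal.ofReal (freq n ^ (2 * s)) * ‖G n τ‖ₑ ^ 2 < ∞ := by
  set F : ℤ → ℝ → ℝ≥0∞ := fun n τ => ∑' k, ‖p (k - n)‖ₑ * ‖C k τ‖ₑ with hF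
  have hFs : ∑' n, ∫⁻ τ, ENNReal.ofReal (freq n ^ (2 * s)) * F n τ ^ 2 < ∞ :=
    tsum_lintegral_conv_lt_top hp hC hCs
  set N := 2 * ⌈|s|⌉₊ + 1 with hN
  set Q : ℤ → ℝ≥0∞ := fun m => ENNReal.ofReal ((1 + |(m : ℝ)|) ^ N) * ‖p m‖ₑ with hQ
  set h : ℤ → ℝ → ℝ≥0∞ := fun k τ =>
    ENNReal.ofReal (freq k ^ r * bracket (τ + (k : ℝ) ^ 2) ^ σ) * ‖G k τ‖ₑ with hh
  have hhm : ∀ k, AEMeasurable (fun τ => h k τ ^ 2) volume := fun k => by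
    refine AEMeasurable.pow_const (AEMeasurable.mul (Measurable.aemeasurable ?_) (hG k).enorm) _
    exact ENNReal.measurable_ofReal.comp
      (((continuous_bracket.measurable.comp (measurable_id.add_const _)).pow_const _).const_mul _)
  have hhs : ∑' k, ∫⁻ τ, h k τ ^ 2 < ∞ := by
    refine lt_of_eq_of_lt ?_ hGs
    unfold bourgainNormSq
    congr 1; funext k
    refine lintegral_congr fun τ => ?_
    have hf := freq_pos k
    have hb := bracket_pos (τ + (k : ℝ) ^ 2)
    rw [hh, mul_pow, ENNReal.ofReal_mul (by positivity), ENNReal.ofReal_mul (by positivity),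
      ofReal_rpow_two_mul hf, ofReal_rpow_two_mul hb, mul_pow]
  have hptk : ∀ n k τ, n ≠ k → ENNReal.ofReal (freq n ^ (2 * s)) *
      (‖G n τ‖ₑ * (‖p (k - n)‖ₑ * ‖G k τ‖ₑ)) ≤ Q (k - n) * (h n τ ^ 2 + h k τ ^ 2) := by
    intro n k τ hnk
    have hn := freq_pos n
    have hk := freq_pos k
    have hbn := bracket_pos (τ + (n : ℝ) ^ 2)
    have hbk := bracket_pos (τ + (k : ℝ) ^ 2)
    have hw := ENNReal.ofReal_le_ofReal (freq_rpow_two_mul_le hσ0 hσ1 hs hnk τ)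
    rw [ENNReal.ofReal_mul (by positivity), ENNReal.ofReal_mul (by positivity)] at hw
    calc _ ≤ _ := mul_le_mul_left hw _
      _ = Q (k - n) * (h n τ * h k τ) := by rw [hQ, hh]; ring
      _ ≤ _ := by
          gcongr
          rcases le_total (h n τ) (h k τ) with hle | hle
          · exact (mul_le_mul_left hle _).trans (by rw [← sq]; exact le_add_self)
          · exact (mul_le_mul_right hle _).trans (by rw [← sq]; exact le_self_add)
  have hpt : ∀ n τ, ‖p 0‖ₑ ^ 2 * (ENNReal.ofReal (freq n ^ (2 * s)) * ‖G n τ‖ₑ ^ 2) ≤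
      ENNReal.ofReal (freq n ^ (2 * s)) * F n τ ^ 2 +
        2 * ‖p 0‖ₑ * ∑' k, Q (k - n) * (h n τ ^ 2 + h k τ ^ 2) := by
    intro n τ
    set R : ℤ → ℂ := fun k => if k = n then 0 else p (k - n) * G k τ with hR
    -- `sq_le_of_le_add` needs `F n τ` finite; where it is infinite the right-hand side is infinite
    -- too.
    by_cases hFtop : F n τ = ∞
    · rw [hFtop]
      have : ENNReal.ofReal (freq n ^ (2 * s)) ≠ 0 := by
        simpa using Real.rpow_pos_of_pos (freq_pos n) _
      simp [ENNReal.mul_top this]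
    have h1 : HasSum (fun k => if k = n then 0 else p (k - n) * (G k τ - C k τ))
        (0 - p 0 * (G n τ - C n τ)) := by
      have := (hGC n τ).sub (hasSum_ite_eq n (p 0 * (G n τ - C n τ)))
      convert! this using 1
      funext k
      by_cases hk : k = n <;> simp [hk]
    -- The diagonal and off-diagonal contributions of `C` together make up `F`; only the
    -- off-diagonal part of `G` remains in `R`.
    have h2 : ‖p 0 * G n τ‖ₑ ≤ F n τ + ∑' k, ‖R k‖ₑ := by
      calc ‖p 0 * G n τ‖ₑ = ‖p 0 * C n τ - (0 - p 0 * (G n τ - C n τ))‖ₑ := by congr 1; ring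
        _ ≤ ‖p 0 * C n τ‖ₑ + ‖0 - p 0 * (G n τ - C n τ)‖ₑ := enorm_sub_le
        _ ≤ ‖p 0 * C n τ‖ₑ + ∑' k, ‖if k = n then 0 else p (k - n) * (G k τ - C k τ)‖ₑ := by
          gcongr
          rw [← h1.tsum_eq]
          exact enorm_tsum_le_tsum_enorm
        _ = ∑' k, ((if k = n then ‖p 0 * C n τ‖ₑ else 0) +
              ‖if k = n then 0 else p (k - n) * (G k τ - C k τ)‖ₑ) := by
          rw [ENNReal.tsum_add, tsum_ite_eq]
        _ ≤ ∑' k, (‖p (k - n)‖ₑ * ‖C k τ‖ₑ + ‖R k‖ₑ) := by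
          refine ENNReal.tsum_le_tsum fun k => ?_
          by_cases hk : k = n
          · simp [hR, hk]
          · simp only [hR, hk, if_false, zero_add]
            rw [← enorm_mul, mul_sub, add_comm]
            exact enorm_sub_le
        _ = _ := ENNReal.tsum_add
    have h3 := sq_le_of_le_add enorm_ne_top hFtop h2
    rw [enorm_mul] at h3
    calc ‖p 0‖ₑ ^ 2 * (ENNReal.ofReal (freq n ^ (2 * s)) * ‖G n τ‖ₑ ^ 2)
        = ENNReal.ofReal (freq n ^ (2 * s)) * (‖p 0‖ₑ * ‖G n τ‖ₑ) ^ 2 := by ring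
      _ ≤ ENNReal.ofReal (freq n ^ (2 * s)) *
            (F n τ ^ 2 + 2 * (‖p 0‖ₑ * ‖G n τ‖ₑ * ∑' k, ‖R k‖ₑ)) := by gcongr
      _ = ENNReal.ofReal (freq n ^ (2 * s)) * F n τ ^ 2 + 2 * ‖p 0‖ₑ *
            ∑' k, ENNReal.ofReal (freq n ^ (2 * s)) * (‖G n τ‖ₑ * ‖R k‖ₑ) := by
          rw [ENNReal.tsum_mul_left, ENNReal.tsum_mul_left]; ring
      _ ≤ _ := by
          refine add_le_add le_rfl (mul_le_mul' le_rfl (ENNReal.tsum_le_tsum fun k => ?_))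
          by_cases hk : k = n
          · simp [hR, hk]
          · simp only [hR, hk, if_false, enorm_mul]
            exact hptk n k τ (Ne.symm hk)
  have hsum : ‖p 0‖ₑ ^ 2 * ∑' n, ∫⁻ τ, ENNReal.ofReal (freq n ^ (2 * s)) * ‖G n τ‖ₑ ^ 2 ≤
      (∑' n, ∫⁻ τ, ENNReal.ofReal (freq n ^ (2 * s)) * F n τ ^ 2) +
        2 * ‖p 0‖ₑ * (2 * ((∑' m, Q m) * ∑' k, ∫⁻ τ, h k τ ^ 2)) := by
    calc _ = ∑' n, ∫⁻ τ, ‖p 0‖ₑ ^ 2 * (ENNReal.ofReal (freq n ^ (2 * s)) * ‖G n τ‖ₑ ^ 2) := by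
          rw [← ENNReal.tsum_mul_left]
          congr 1; funext n
          rw [lintegral_const_mul' (‖p 0‖ₑ ^ 2) _ (by finiteness)]
      _ ≤ ∑' n, ∫⁻ τ, (ENNReal.ofReal (freq n ^ (2 * s)) * F n τ ^ 2 +
            2 * ‖p 0‖ₑ * ∑' k, Q (k - n) * (h n τ ^ 2 + h k τ ^ 2)) :=
          ENNReal.tsum_le_tsum fun n => lintegral_mono (hpt n)
      _ = ∑' n, ((∫⁻ τ, ENNReal.ofReal (freq n ^ (2 * s)) * F n τ ^ 2) +
            2 * ‖p 0‖ₑ * ∑' k, (Q (k - n) * (∫⁻ τ, h n τ ^ 2) +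
              Q (k - n) * ∫⁻ τ, h k τ ^ 2)) := by
          congr 1; funext n
          have hm1 : ∀ k, AEMeasurable (fun τ => Q (k - n) * (h n τ ^ 2 + h k τ ^ 2)) volume :=
            fun k => ((hhm n).add (hhm k)).const_mul _
          rw [lintegral_add_right' _ ((AEMeasurable.tsum hm1).const_mul _),
            lintegral_const_mul' (2 * ‖p 0‖ₑ) _ (by finiteness), lintegral_tsum hm1]
          congr 3; funext k
          rw [lintegral_const_mul'' (f := fun τ => h n τ ^ 2 + h k τ ^ 2) _
            ((hhm n).add (hhm k)), lintegral_add_left' (hhm n), mul_add]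
      _ = _ := by
          rw [ENNReal.tsum_add, ENNReal.tsum_mul_left]
          congr 2
          simp only [ENNReal.tsum_add]
          rw [two_mul]
          congr 1
          · rw [← ENNReal.tsum_mul_left]
            congr 1; funext n
            rw [ENNReal.tsum_mul_right, tsum_shift Q]
          · rw [ENNReal.tsum_comm, ← ENNReal.tsum_mul_left]
            congr 1; funext k
            rw [ENNReal.tsum_mul_right, tsum_shift' Q]
  have hQs : ∑' m, Q m < ∞ := hp.tsum_lt_top N
  have hfin : ‖p 0‖ₑ ^ 2 * ∑' n, ∫⁻ τ, ENNReal.ofReal (freq n ^ (2 * s)) * ‖G n τ‖ₑ ^ 2 < ∞ := by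
    refine hsum.trans_lt (ENNReal.add_lt_top.2 ⟨hFs, ?_⟩)
    have := hQs.ne
    have := hhs.ne
    finiteness
  by_contra htop
  rw [not_lt, top_le_iff] at htop
  rw [htop, ENNReal.mul_top (by simpa using hp0)] at hfin
  exact lt_irrefl _ hfin

end

/-! ### Product test functions, complexification, cutoffs. -/

noncomputable section

open scoped ContDiff

/-- Smooth functions on the line with compact support contained in `I`. -/
structure IsTest {F : Type*} [NormedAddCommGroup F] [NormedSpace ℝ F] (I : Set ℝ) (α : ℝ → F) :
    Prop where
  contDiff : ContDiff ℝ ∞ α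
  hasCompactSupport : HasCompactSupport α
  subset : tsupport α ⊆ I

namespace IsTest

variable {F : Type*} [NormedAddCommGroup F] [NormedSpace ℝ F] {I : Set ℝ} {α : ℝ → F}

theorem mono {J : Set ℝ} (h : IsTest I α) (hIJ : I ⊆ J) : IsTest J α :=
  ⟨h.1, h.2, h.3.trans hIJ⟩

theorem integrable (h : IsTest I α) : Integrable α :=
  h.1.continuous.integrable_of_hasCompactSupport h.2

theorem memLp (h : IsTest I α) (q : ℝ≥0∞) : MemLp α q :=
  h.1.continuous.memLp_of_hasCompactSupport h.2

theorem deriv (h : IsTest I α) : IsTest I (deriv α) :=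
  ⟨h.1.deriv', h.2.deriv, (tsupport_deriv_subset (𝕜 := ℝ)).trans h.3⟩

theorem clm_comp {G : Type*} [NormedAddCommGroup G] [NormedSpace ℝ G] (L : F →L[ℝ] G)
    (h : IsTest I α) : IsTest I (fun t => L (α t)) :=
  ⟨L.contDiff.comp h.1, h.2.comp_left (map_zero L),
    (tsupport_comp_subset (map_zero L) α).trans h.3⟩

theorem ofReal {α : ℝ → ℝ} (h : IsTest I α) : IsTest I (fun t => (α t : ℂ)) :=
  h.clm_comp Complex.ofRealCLM

theorem mul_exp {α : ℝ → ℂ} (h : IsTest I α) (η : ℝ) :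
    IsTest I (fun t => α t * Complex.exp (Complex.I * (η * t))) := by
  refine ⟨?_, h.2.mul_right, (tsupport_mul_subset_left).trans h.3⟩
  refine h.1.mul ((contDiff_const.mul (contDiff_const.mul ?_)).cexp)
  exact Complex.ofRealCLM.contDiff

end IsTest

/-- The test function `α(t) β(x)`. -/
def tensorTest (U : Opens (ℝ × ℝ)) {I J : Set ℝ} {α β : ℝ → ℝ} (hα : IsTest I α)
    (hβ : IsTest J β) (hU : I ×ˢ J ⊆ U) : 𝓓(U, ℝ) where
  toFun p := α p.1 * β p.2
  contDiff' := (hα.1.comp contDiff_fst).mul (hβ.1.comp contDiff_snd)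
  hasCompactSupport' := by
    refine HasCompactSupport.intro (hα.2.isCompact.prod hβ.2.isCompact) fun p hp => ?_
    rw [mem_prod, not_and_or] at hp
    rcases hp with hp | hp <;> simp [image_eq_zero_of_notMem_tsupport hp]
  tsupport_subset' := by
    refine (closure_minimal ?_ ((isClosed_tsupport α).prod (isClosed_tsupport β))).trans
      ((prod_mono hα.3 hβ.3).trans hU)
    intro p hp
    rw [Function.mem_support, mul_ne_zero_iff] at hp
    exact ⟨subset_tsupport _ hp.1, subset_tsupport _ hp.2⟩

@[simp]
theorem tensorTest_apply {U : Opens (ℝ × ℝ)} {I J : Set ℝ} {α β : ℝ → ℝ} (hα : IsTest I α)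
    (hβ : IsTest J β) (hU : I ×ˢ J ⊆ U) (p : ℝ × ℝ) :
    tensorTest U hα hβ hU p = α p.1 * β p.2 := rfl

theorem lineDeriv_fst_tensorTest {U : Opens (ℝ × ℝ)} {I J : Set ℝ} {α β : ℝ → ℝ}
    (hα : IsTest I α) (hβ : IsTest J β) (hU : I ×ˢ J ⊆ U) :
    ∂_{((1 : ℝ), (0 : ℝ))} (tensorTest U hα hβ hU) = tensorTest U hα.deriv hβ hU := by
  refine TestFunction.ext fun p => ?_
  rw [TestFunction.lineDerivOp_eq_lineDerivCLM (𝕜 := ℝ),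
    TestFunction.lineDerivCLM_apply_of_le (by simp)]
  simp only [tensorTest_apply, lineDeriv, Prod.fst_add, Prod.snd_add, Prod.smul_fst, Prod.smul_snd,
    smul_eq_mul, mul_one, mul_zero, add_zero]
  rw [deriv_mul_const_field, deriv_comp_const_add, add_zero]

theorem lineDeriv_snd_tensorTest {U : Opens (ℝ × ℝ)} {I J : Set ℝ} {α β : ℝ → ℝ}
    (hα : IsTest I α) (hβ : IsTest J β) (hU : I ×ˢ J ⊆ U) :
    ∂_{((0 : ℝ), (1 : ℝ))} (tensorTest U hα hβ hU) = tensorTest U hα hβ.deriv hU := by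
  refine TestFunction.ext fun p => ?_
  rw [TestFunction.lineDerivOp_eq_lineDerivCLM (𝕜 := ℝ),
    TestFunction.lineDerivCLM_apply_of_le (by simp)]
  simp only [tensorTest_apply, lineDeriv, Prod.fst_add, Prod.snd_add, Prod.smul_fst, Prod.smul_snd,
    smul_eq_mul, mul_one, mul_zero, add_zero]
  rw [deriv_const_mul_field, deriv_comp_const_add, add_zero]

theorem prod_univ_subset_cylinder (T : ℝ) :
    Ioo 0 T ×ˢ univ ⊆ (cylinder T ⊤ : Set (ℝ × ℝ)) :=
  fun _ hp => ⟨hp.1, trivial⟩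

/-- Each derivative moved to the test function changes the sign: once in time, twice in space. -/
theorem schrodinger_tensorTest {T : ℝ} (u : 𝓓'(cylinder T ⊤, ℂ)) {α β : ℝ → ℝ}
    (hα : IsTest (Ioo 0 T) α) (hβ : IsTest univ β) :
    schrodinger u (tensorTest _ hα hβ (prod_univ_subset_cylinder T)) =
      -Complex.I * u (tensorTest _ hα.deriv hβ (prod_univ_subset_cylinder T)) +
        u (tensorTest _ hα hβ.deriv.deriv (prod_univ_subset_cylinder T)) := by
  have h1 := Distribution.lineDerivOp_apply_apply u
    (tensorTest _ hα hβ (prod_univ_subset_cylinder T)) ((1 : ℝ), (0 : ℝ))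
  have h2 := Distribution.lineDerivOp_apply_apply (∂_{((0 : ℝ), (1 : ℝ))} u)
    (tensorTest _ hα hβ (prod_univ_subset_cylinder T)) ((0 : ℝ), (1 : ℝ))
  have h3 := Distribution.lineDerivOp_apply_apply u
    (tensorTest _ hα hβ.deriv (prod_univ_subset_cylinder T)) ((0 : ℝ), (1 : ℝ))
  rw [lineDeriv_snd_tensorTest, map_neg] at h2 h3
  rw [h3, neg_neg] at h2
  rw [lineDeriv_fst_tensorTest, map_neg] at h1
  change Complex.I • (∂_{((1 : ℝ), (0 : ℝ))} u) _ +
    (∂_{((0 : ℝ), (1 : ℝ))} (∂_{((0 : ℝ), (1 : ℝ))} u)) _ = _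
  rw [h1, h2, smul_eq_mul]
  ring

theorem integral_tensor_exp (α β : ℝ → ℝ) (τ : ℝ) (k : ℤ) :
    ∫ p : ℝ × ℝ, ((α p.1 * β p.2 : ℝ) : ℂ) * Complex.exp (Complex.I * (τ * p.1 + k * p.2)) =
      ft (fun t => α t) τ * ft (fun x => β x) k := by
  rw [ft, ft, ← integral_prod_mul]
  refine integral_congr_ae (.of_forall fun p => ?_)
  simp only [Complex.ofReal_mul, mul_add, Complex.exp_add, Complex.ofReal_intCast]
  ring

/-- A distribution in a Bourgain space tested against a product. -/
theorem hasSum_tensorTest_of_hasSpaceTimeFourier {T : ℝ} {w : 𝓓'((⊤ : Opens (ℝ × ℝ)), ℂ)}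
    {g : ℝ → ℤ → ℂ} (hw : HasSpaceTimeFourier w g) {α β : ℝ → ℝ}
    (hα : IsTest (Ioo 0 T) α) (hβ : IsTest univ β) :
    HasSum (fun k : ℤ => (2 * π : ℂ)⁻¹ *
      (∫ τ, g τ k * ft (fun t => α t) τ) * ft (fun x => β x) k)
      (restrict le_top w (tensorTest (cylinder T ⊤) hα hβ (prod_univ_subset_cylinder T))) := by
  obtain ⟨ψ, hψ, hres⟩ := restrict_apply le_top w
    (tensorTest (cylinder T ⊤) hα hβ (prod_univ_subset_cylinder T))
  rw [hres]
  convert hw ψ using 1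
  funext k
  rw [mul_assoc, ← integral_mul_const]
  congr 2
  funext τ
  rw [hψ, mul_assoc, ← integral_tensor_exp]
  rfl

theorem hasSum_tensorTest_of_hasSpaceFourier {T : ℝ} {v : 𝓓'(cylinder T ⊤, ℂ)}
    {c : ℝ → ℤ → ℂ} (hv : HasSpaceFourier T v c) {α β : ℝ → ℝ}
    (hα : IsTest (Ioo 0 T) α) (hβ : IsTest univ β) :
    HasSum (fun k : ℤ => (∫ t in Ioo 0 T, c t k * α t) * ft (fun x => β x) k)
      (v (tensorTest (cylinder T ⊤) hα hβ (prod_univ_subset_cylinder T))) := by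
  have h := hv (tensorTest (cylinder T ⊤) hα hβ (prod_univ_subset_cylinder T))
  convert h using 1
  funext k
  rw [← integral_mul_const]
  refine integral_congr_ae (.of_forall fun t => ?_)
  simp only [tensorTest_apply, ft, Complex.ofReal_mul, Complex.ofReal_intCast, mul_assoc]
  rw [integral_const_mul]

/-- A relation between Fourier coefficients that holds when tested against products of real
functions extends to products of complex functions. -/
theorem hasSum_complexify {I J : Set ℝ} {D : ℤ → (ℝ → ℂ) → ℂ}
    (hD : ∀ k, ∀ α₁ α₂ : ℝ → ℂ, IsTest I α₁ → IsTest I α₂ →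
      D k (fun t => α₁ t + Complex.I * α₂ t) = D k α₁ + Complex.I * D k α₂)
    (h : ∀ α β : ℝ → ℝ, IsTest I α → IsTest J β →
      HasSum (fun k : ℤ => D k (fun t => α t) * ft (fun x => β x) k) 0)
    {α β : ℝ → ℂ} (hα : IsTest I α) (hβ : IsTest J β) :
    HasSum (fun k : ℤ => D k α * ft β k) 0 := by
  have hsplit : ∀ γ : ℝ → ℂ, γ = fun t => ((γ t).re : ℂ) + Complex.I * ((γ t).im : ℂ) :=
    fun γ => by
      funext t; rw [mul_comm]; exact (Complex.re_add_im _).symm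
  have hre : ∀ {K : Set ℝ} {γ : ℝ → ℂ}, IsTest K γ → IsTest K (fun t => (γ t).re) :=
    fun hγ => hγ.clm_comp Complex.reCLM
  have him : ∀ {K : Set ℝ} {γ : ℝ → ℂ}, IsTest K γ → IsTest K (fun t => (γ t).im) :=
    fun hγ => hγ.clm_comp Complex.imCLM
  have h1 : ∀ a : ℝ → ℝ, IsTest I a → HasSum (fun k : ℤ => D k (fun t => a t) * ft β k) 0 := by
    intro a ha
    have := (h a _ ha (hre hβ)).add ((h a _ ha (him hβ)).mul_left Complex.I)
    rw [mul_zero, add_zero] at this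
    convert this using 1
    funext k
    conv_lhs => rw [hsplit β]
    have hi : Integrable (fun t => Complex.I * ((β t).im : ℂ)) :=
      (him hβ).ofReal.integrable.const_mul _
    rw [ft_add (hre hβ).ofReal.integrable hi, ft_const_mul]
    ring
  have := (h1 _ (hre hα)).add ((h1 _ (him hα)).mul_left Complex.I)
  rw [mul_zero, add_zero] at this
  convert this using 1
  funext k
  conv_lhs => rw [hsplit α]
  rw [hD k _ _ (hre hα).ofReal (him hα).ofReal]
  ring

/-- A function whose translates by `2πℤ` form a partition of unity. -/
theorem exists_isTest_ft_eq_ite :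
    ∃ η : ℝ → ℂ, IsTest univ η ∧ ∀ m : ℤ, ft η m = if m = 0 then 2 * π else 0 := by
  have hπ := Real.pi_pos
  -- The difference `S x - S (x - 2π)` has translates whose sum telescopes to `1`.
  set S := Real.smoothTransition
  have hSc : Continuous S := Real.smoothTransition.continuous
  have hη : IsTest univ (fun x => S x - S (x - 2 * π)) := by
    refine ⟨?_, ?_, subset_univ _⟩
    · exact Real.smoothTransition.contDiff.sub
        (Real.smoothTransition.contDiff.comp (contDiff_id.sub contDiff_const))
    · refine HasCompactSupport.intro (isCompact_Icc (a := 0) (b := 2 * π + 1)) fun x hx => ?_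
      rw [mem_Icc, not_and_or, not_le, not_le] at hx
      rcases hx with hx | hx
      · simp [S, Real.smoothTransition.zero_of_nonpos hx.le,
          Real.smoothTransition.zero_of_nonpos (by linarith : x - 2 * π ≤ 0)]
      · simp [S, Real.smoothTransition.one_of_one_le (by linarith : 1 ≤ x),
          Real.smoothTransition.one_of_one_le (by linarith : 1 ≤ x - 2 * π)]
  refine ⟨_, hη.ofReal, fun m => ?_⟩
  set e : ℝ → ℂ := fun x => Complex.exp (Complex.I * (((m : ℤ) : ℝ) * x)) with he
  have hec : Continuous e := by fun_prop
  have hper : ∀ x, e (x - 2 * π) = e x := fun x => by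
    simp only [he]
    rw [Complex.exp_eq_exp_iff_exists_int]
    exact ⟨-m, by push_cast; ring⟩
  have hint : ∀ a b : ℝ, IntervalIntegrable (fun x => (S x : ℂ) * e x) volume a b :=
    fun a b => Continuous.intervalIntegrable (by fun_prop) a b
  have hzero : ∫ x in (-(2 * π))..0, (S x : ℂ) * e x = 0 := by
    rw [intervalIntegral.integral_congr (g := fun _ => 0)]
    · simp
    · intro x hx
      rw [uIcc_of_le (by linarith)] at hx
      simp [S, Real.smoothTransition.zero_of_nonpos hx.2]
  have hone : ∫ x in (1 : ℝ)..(2 * π + 1), (S x : ℂ) * e x = ∫ x in (1 : ℝ)..(2 * π + 1), e x := by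
    refine intervalIntegral.integral_congr fun x hx => ?_
    rw [uIcc_of_le (by linarith)] at hx
    simp [S, Real.smoothTransition.one_of_one_le hx.1]
  have h1 : ft (fun x => ((S x - S (x - 2 * π) : ℝ) : ℂ)) m =
      ∫ x in (0 : ℝ)..(2 * π + 1), ((S x - S (x - 2 * π) : ℝ) : ℂ) * e x := by
    rw [intervalIntegral.integral_eq_integral_of_support_subset]
    · rfl
    · intro x hx
      by_contra hx'
      refine hx ?_
      rw [mem_Ioc, not_and_or, not_lt, not_le] at hx'
      rcases hx' with hx' | hx'
      · simp [S, Real.smoothTransition.zero_of_nonpos hx',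
          Real.smoothTransition.zero_of_nonpos (by linarith : x - 2 * π ≤ 0)]
      · simp [S, Real.smoothTransition.one_of_one_le (by linarith : 1 ≤ x),
          Real.smoothTransition.one_of_one_le (by linarith : 1 ≤ x - 2 * π)]
  -- Translating the second integral to `[-2π, 1]` makes everything cancel except the integral of
  -- `e` over the full period `[1, 2π + 1]`.
  have h2 : ∫ x in (0 : ℝ)..(2 * π + 1), ((S x - S (x - 2 * π) : ℝ) : ℂ) * e x =
      (∫ x in (0 : ℝ)..(2 * π + 1), (S x : ℂ) * e x) -
        ∫ x in (0 : ℝ)..(2 * π + 1), (fun y => (S y : ℂ) * e y) (x - 2 * π) := by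
    rw [← intervalIntegral.integral_sub (hint _ _)
      (Continuous.intervalIntegrable (by fun_prop) _ _)]
    refine intervalIntegral.integral_congr fun x _ => ?_
    simp only [hper]
    push_cast
    ring
  have h3 : ∫ x in (1 : ℝ)..(2 * π + 1), e x = if m = 0 then 2 * π else 0 := by
    split_ifs with hm
    · simp [he, hm]
    · have hm' : Complex.I * (m : ℂ) ≠ 0 := by simp [hm]
      have : e = fun x : ℝ => Complex.exp (Complex.I * (m : ℂ) * x) := by
        funext x; simp only [he]; push_cast; ring_nf
      rw [this, integral_exp_mul_complex hm']
      have h4 := hper (2 * π + 1)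
      rw [this] at h4
      simp only [add_sub_cancel_left] at h4
      rw [← h4, sub_self, zero_div, Complex.ofReal_zero]
  rw [h1, h2, intervalIntegral.integral_comp_sub_right (fun y => (S y : ℂ) * e y), zero_sub,
    add_sub_cancel_left,
    ← intervalIntegral.integral_add_adjacent_intervals (hint 0 1) (hint 1 (2 * π + 1)),
    ← intervalIntegral.integral_add_adjacent_intervals (hint (-(2 * π)) 0) (hint 0 1), hzero, hone,
    h3]
  ring

theorem isTest_contDiffBump {c : ℝ} (f : ContDiffBump c) {I : Set ℝ}
    (hI : Metric.closedBall c f.rOut ⊆ I) : IsTest I (f : ℝ → ℝ) :=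
  ⟨f.contDiff, f.hasCompactSupport, by rwa [f.tsupport_eq]⟩

theorem exists_cutoff {T : ℝ} (hT : 0 < T) {K : Set ℝ} (hK : IsCompact K) (hKT : K ⊆ Ioo 0 T) :
    ∃ χ : ℝ → ℝ, IsTest (Ioo 0 T) χ ∧ (∀ t ∈ K, χ t = 1) ∧ ∀ t, |χ t| ≤ 1 := by
  have hball : Ioo 0 T = Metric.ball (T / 2) (T / 2) := by
    rw [Real.ball_eq_Ioo]; congr 1 <;> ring
  rw [hball] at hKT
  obtain ⟨R, hR, hKR⟩ := exists_pos_lt_subset_ball (by linarith) hK.isClosed hKT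
  let f : ContDiffBump (T / 2) := ⟨R, (R + T / 2) / 2, hR.1, by linarith [hR.2]⟩
  refine ⟨f, isTest_contDiffBump f ?_, fun t ht => ?_, fun t => ?_⟩
  · rw [hball]
    exact Metric.closedBall_subset_ball (by change (R + T / 2) / 2 < T / 2; linarith [hR.2])
  · exact f.one_of_mem_closedBall (Metric.ball_subset_closedBall (hKR ht))
  · rw [abs_of_nonneg f.nonneg]
    exact f.le_one

/-- The nonzero mean provides the diagonal coefficient `p 0 ≠ 0` by which the core estimate divides.
-/
theorem exists_bump {J : Set ℝ} (hJ : IsOpen J) (hne : J.Nonempty) :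
    ∃ φ : ℝ → ℂ, IsTest J φ ∧ ft φ 0 ≠ 0 := by
  obtain ⟨x, hx⟩ := hne
  obtain ⟨ε, hε, hball⟩ := Metric.isOpen_iff.1 hJ x hx
  let f : ContDiffBump x := ⟨ε / 4, ε / 2, by linarith, by linarith⟩
  have hf : IsTest J (f : ℝ → ℝ) := isTest_contDiffBump f
    ((Metric.closedBall_subset_ball (by change ε / 2 < ε; linarith)).trans hball)
  refine ⟨_, hf.ofReal, ?_⟩
  simp only [ft, Complex.ofReal_zero, zero_mul, mul_zero, Complex.exp_zero, mul_one]
  rw [integral_complex_ofReal]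
  exact_mod_cast (f.integral_pos (μ := volume)).ne'

end

/-! ### The equation at each frequency. -/

noncomputable section

theorem measurable_bracket_rpow (m a : ℝ) : Measurable fun τ => bracket (τ + m) ^ a :=
  (continuous_bracket.measurable.comp (measurable_id.add_const m)).pow_const _

theorem memLp_two_of_lintegral_lt_top {X : Type*} [MeasurableSpace X] {μ : Measure X} {f : X → ℂ}
    (hf : AEStronglyMeasurable f μ) (h : ∫⁻ x, ‖f x‖ₑ ^ 2 ∂μ < ∞) : MemLp f 2 μ := by
  refine ⟨hf, ?_⟩
  rw [eLpNorm_eq_lintegral_rpow_enorm_toReal (by norm_num) (by norm_num)]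
  simp only [ENNReal.toReal_ofNat, ENNReal.rpow_ofNat]
  exact ENNReal.rpow_lt_top_of_nonneg (by norm_num) h.ne

/-- Split the product as `⟨τ+m⟩^a g` times `⟨τ+m⟩^{-a} h`, both in `L²`: since `|a| ≤ 1`, one of the
two powers of decay of `h` absorbs the weight and the other gives square integrability. -/
theorem integrable_mul_of_weight {g h : ℝ → ℂ} {a m : ℝ} (ha : |a| ≤ 1)
    (hg : AEStronglyMeasurable g volume)
    (hgw : ∫⁻ τ, ENNReal.ofReal (bracket (τ + m) ^ (2 * a)) * ‖g τ‖ₑ ^ 2 < ∞)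
    (hh : Continuous h) {C : ℝ} (hC : ∀ τ, (1 + |τ|) ^ 2 * ‖h τ‖ ≤ C) :
    Integrable fun τ => g τ * h τ := by
  have hC0 : 0 ≤ C := le_trans (by positivity) (hC 0)
  have h1 : MemLp (fun τ => ((bracket (τ + m) ^ a : ℝ) : ℂ) * g τ) 2 := by
    refine memLp_two_of_lintegral_lt_top ?_ (lt_of_eq_of_lt (lintegral_congr fun τ => ?_) hgw)
    · exact (Complex.measurable_ofReal.comp
        (measurable_bracket_rpow m a)).aestronglyMeasurable.mul hg
    · have hb := bracket_pos (τ + m)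
      rw [enorm_mul, mul_pow, ofReal_rpow_two_mul hb, ← ofReal_norm (_ : ℂ), Complex.norm_real,
        Real.norm_of_nonneg (by positivity)]
  have h2 : MemLp (fun τ => ((bracket (τ + m) ^ (-a) : ℝ) : ℂ) * h τ) 2 := by
    have hmeas : AEStronglyMeasurable (fun τ => ((bracket (τ + m) ^ (-a) : ℝ) : ℂ) * h τ) volume :=
      (Complex.measurable_ofReal.comp
        (measurable_bracket_rpow m (-a))).aestronglyMeasurable.mul hh.aestronglyMeasurable
    refine (memLp_two_iff_integrable_sq_norm hmeas).2 ?_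
    refine Integrable.mono' (integrable_inv_one_add_sq.const_mul ((C * (1 + |m|)) ^ 2))
      (hmeas.norm.pow 2) (.of_forall fun τ => ?_)
    have hb := bracket_pos (τ + m)
    have h3 : bracket (τ + m) ^ (-a) ≤ (1 + |m|) * (1 + |τ|) :=
      calc bracket (τ + m) ^ (-a) ≤ bracket (τ + m) ^ (1 : ℝ) :=
            Real.rpow_le_rpow_of_exponent_le (one_le_bracket _)
              ((neg_le_abs a).trans ha)
        _ = bracket (τ + m) := Real.rpow_one _
        _ ≤ 1 + |τ + m| := bracket_le_one_add_abs _
        _ ≤ _ := by nlinarith [abs_add_le τ m, abs_nonneg τ, abs_nonneg m]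
    have h4 : ‖((bracket (τ + m) ^ (-a) : ℝ) : ℂ) * h τ‖ * (1 + |τ|) ≤ C * (1 + |m|) := by
      rw [norm_mul, Complex.norm_real, Real.norm_of_nonneg (by positivity)]
      calc _ ≤ (1 + |m|) * (1 + |τ|) * ‖h τ‖ * (1 + |τ|) := by gcongr
        _ = (1 + |m|) * ((1 + |τ|) ^ 2 * ‖h τ‖) := by ring
        _ ≤ (1 + |m|) * C := by gcongr; exact hC τ
        _ = _ := by ring
    rw [Real.norm_of_nonneg (by positivity), ← div_eq_mul_inv, le_div_iff₀ (by positivity)]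
    calc _ ≤ ‖((bracket (τ + m) ^ (-a) : ℝ) : ℂ) * h τ‖ ^ 2 * (1 + |τ|) ^ 2 := by
          gcongr
          rw [add_sq, sq_abs]
          nlinarith [abs_nonneg τ]
      _ = (‖((bracket (τ + m) ^ (-a) : ℝ) : ℂ) * h τ‖ * (1 + |τ|)) ^ 2 := by ring
      _ ≤ _ := by gcongr
  refine (h1.integrable_mul h2).congr (.of_forall fun τ => ?_)
  have hb := bracket_pos (τ + m)
  have h5 : (bracket (τ + m) ^ a : ℝ) * bracket (τ + m) ^ (-a) = 1 := by
    rw [← Real.rpow_add hb, add_neg_cancel, Real.rpow_zero]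
  simp only [Pi.mul_apply]
  calc _ = (((bracket (τ + m) ^ a : ℝ) * bracket (τ + m) ^ (-a) : ℝ) : ℂ) * (g τ * h τ) := by
        push_cast; ring
    _ = _ := by rw [h5, Complex.ofReal_one, one_mul]

theorem lintegral_lt_top_of_bourgainNormSq {s a : ℝ} {g : ℝ → ℤ → ℂ}
    (h : bourgainNormSq s a g < ∞) (k : ℤ) :
    ∫⁻ τ, ENNReal.ofReal (bracket (τ + (k : ℝ) ^ 2) ^ (2 * a)) * ‖g τ k‖ₑ ^ 2 < ∞ := by
  have h1 := (ENNReal.le_tsum k).trans_lt h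
  have hf := freq_pos k
  simp only [ENNReal.ofReal_mul (Real.rpow_nonneg hf.le _), mul_assoc] at h1
  rw [lintegral_const_mul' _ _ ENNReal.ofReal_ne_top] at h1
  refine ENNReal.lt_top_of_mul_ne_top_right h1.ne ?_
  simpa using Real.rpow_pos_of_pos hf _

theorem bourgainNormSq_eq (s a : ℝ) (g : ℝ → ℤ → ℂ) :
    bourgainNormSq s a g = ∑' k : ℤ, ENNReal.ofReal (freq k ^ (2 * s)) *
      ∫⁻ τ, ENNReal.ofReal (bracket (τ + (k : ℝ) ^ 2) ^ (2 * a)) * ‖g τ k‖ₑ ^ 2 := by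
  unfold bourgainNormSq
  congr 1; funext k
  rw [← lintegral_const_mul' _ _ ENNReal.ofReal_ne_top]
  refine lintegral_congr fun τ => ?_
  rw [ENNReal.ofReal_mul (Real.rpow_nonneg (freq_pos k).le _), mul_assoc]

/-- The Fourier coefficients of a distribution given by `g` are integrable against the Fourier
transform of a test function. -/
theorem integrable_mul_ft {I : Set ℝ} {s a : ℝ} (ha : |a| ≤ 1) {g : ℝ → ℤ → ℂ}
    (hg : ∀ k, AEStronglyMeasurable (fun τ => g τ k) volume) (hgs : bourgainNormSq s a g < ∞)
    (k : ℤ) {α : ℝ → ℂ} (hα : IsTest I α) : Integrable fun τ => g τ k * ft α τ := by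
  obtain ⟨C, -, hC⟩ := ft_decay hα.1 hα.2 2
  exact integrable_mul_of_weight ha (hg k) (lintegral_lt_top_of_bourgainNormSq hgs k)
    (continuous_ft hα.integrable) hC

theorem ft_deriv_ofReal {α : ℝ → ℝ} {I : Set ℝ} (hα : IsTest I α) (τ : ℝ) :
    ft (fun t => ((deriv α t : ℝ) : ℂ)) τ = -(Complex.I * τ) * ft (fun t => (α t : ℂ)) τ := by
  rw [← ft_deriv hα.ofReal.1 hα.ofReal.2]
  congr 1
  funext t
  exact ((hα.1.differentiable (by norm_cast) t).hasDerivAt.ofReal_comp).deriv.symm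

theorem integrable_schrodinger_mul_ft {I : Set ℝ} {r b : ℝ} (hb : |b| ≤ 1) {gu gf : ℝ → ℤ → ℂ}
    (hgu : ∀ k, AEStronglyMeasurable (fun τ => gu τ k) volume)
    (hgus : bourgainNormSq r b gu < ∞)
    (hgf : ∀ k, AEStronglyMeasurable (fun τ => gf τ k) volume)
    (hgfs : bourgainNormSq r (-b) gf < ∞) (k : ℤ) {α : ℝ → ℂ} (hα : IsTest I α) :
    Integrable (fun τ => gu τ k * ((τ : ℂ) * ft α τ)) ∧
      Integrable fun τ => (gu τ k * ((τ + (k : ℝ) ^ 2 : ℝ) : ℂ) + gf τ k) * ft α τ := by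
  have h1 : Integrable fun τ => gu τ k * ((τ : ℂ) * ft α τ) := by
    refine ((integrable_mul_ft hb hgu hgus k hα.deriv).const_mul Complex.I).congr
      (.of_forall fun τ => ?_)
    simp only [ft_deriv hα.1 hα.2]
    linear_combination (-gu τ k * τ * ft α τ) * Complex.I_mul_I
  refine ⟨h1, ((h1.add ((integrable_mul_ft hb hgu hgus k hα).const_mul ((k : ℂ) ^ 2))).add
    (integrable_mul_ft (by rwa [abs_neg]) hgf hgfs k hα)).congr (.of_forall fun τ => ?_)⟩
  simp only [Pi.add_apply]
  push_cast
  ring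

/-- The equation `i ∂ₜ u + ∂ₓ² u = f` on `]0,T[ × 𝕋`, frequency by frequency. -/
theorem integral_schrodinger_eq_zero {T r b : ℝ} (hb : |b| ≤ 1)
    {wu wf : 𝓓'((⊤ : Opens (ℝ × ℝ)), ℂ)} {gu gf : ℝ → ℤ → ℂ}
    (hgu : ∀ k, AEStronglyMeasurable (fun τ => gu τ k) volume)
    (hgus : bourgainNormSq r b gu < ∞) (hu : HasSpaceTimeFourier wu gu)
    (hgf : ∀ k, AEStronglyMeasurable (fun τ => gf τ k) volume)
    (hgfs : bourgainNormSq r (-b) gf < ∞) (hf : HasSpaceTimeFourier wf gf)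
    (heq : schrodinger (restrict (le_top : cylinder T ⊤ ≤ ⊤) wu) = restrict le_top wf)
    (k : ℤ) {α : ℝ → ℂ} (hα : IsTest (Ioo 0 T) α) :
    ∫ τ, (gu τ k * ((τ + (k : ℝ) ^ 2 : ℝ) : ℂ) + gf τ k) * ft α τ = 0 := by
  have hb' : |-b| ≤ 1 := by rwa [abs_neg]
  have hπ : (π : ℂ) ≠ 0 := by exact_mod_cast Real.pi_ne_zero
  have iu : ∀ k : ℤ, ∀ {α : ℝ → ℂ}, IsTest (Ioo 0 T) α → Integrable fun τ => gu τ k * ft α τ :=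
    fun k _ h => integrable_mul_ft hb hgu hgus k h
  have igf : ∀ k : ℤ, ∀ {α : ℝ → ℂ}, IsTest (Ioo 0 T) α → Integrable fun τ => gf τ k * ft α τ :=
    fun k _ h => integrable_mul_ft hb' hgf hgfs k h
  have iut : ∀ k : ℤ, ∀ {α : ℝ → ℂ}, IsTest (Ioo 0 T) α →
      Integrable fun τ => gu τ k * ((τ : ℂ) * ft α τ) := fun k _ h =>
    (integrable_schrodinger_mul_ft hb hgu hgus hgf hgfs k h).1
  have isum : ∀ k : ℤ, ∀ {α : ℝ → ℂ}, IsTest (Ioo 0 T) α →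
      Integrable fun τ => (gu τ k * ((τ + (k : ℝ) ^ 2 : ℝ) : ℂ) + gf τ k) * ft α τ :=
    fun k _ h => (integrable_schrodinger_mul_ft hb hgu hgus hgf hgfs k h).2
  set D : ℤ → (ℝ → ℂ) → ℂ := fun k α =>
    ∫ τ, (gu τ k * ((τ + (k : ℝ) ^ 2 : ℝ) : ℂ) + gf τ k) * ft α τ with hDdef
  have hadd : ∀ k, ∀ α₁ α₂ : ℝ → ℂ, IsTest (Ioo 0 T) α₁ → IsTest (Ioo 0 T) α₂ →
      D k (fun t => α₁ t + Complex.I * α₂ t) = D k α₁ + Complex.I * D k α₂ := by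
    intro k α₁ α₂ h1 h2
    simp only [hDdef]
    rw [← integral_const_mul, ← integral_add (isum k h1) ((isum k h2).const_mul _)]
    congr 1; funext τ
    rw [ft_add h1.integrable (h2.integrable.const_mul _), ft_const_mul]
    ring
  have hreal : ∀ α β : ℝ → ℝ, IsTest (Ioo 0 T) α → IsTest univ β →
      HasSum (fun k : ℤ => D k (fun t => α t) * ft (fun x => β x) k) 0 := by
    intro α β hα hβ
    have e1 := hasSum_tensorTest_of_hasSpaceTimeFourier hu hα.deriv hβ
    have e2 := hasSum_tensorTest_of_hasSpaceTimeFourier hu hα hβ.deriv.deriv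
    have e3 := hasSum_tensorTest_of_hasSpaceTimeFourier hf hα hβ
    -- The operator has symbol `-(τ + k²)`; the factor `-2π` removes this sign and the normalization
    -- `(2π)⁻¹`.
    have e4 := (((e1.mul_left (-Complex.I)).add e2).sub e3).mul_left (-(2 * π : ℂ))
    rw [← schrodinger_tensorTest, heq, sub_self, mul_zero] at e4
    convert! e4 using 1
    funext k
    have i1 := iu k hα.ofReal
    have i2 := iut k hα.ofReal
    have i3 := igf k hα.ofReal
    have hD : D k (fun t => α t) = (∫ τ, gu τ k * ((τ : ℂ) * ft (fun t => α t) τ)) +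
        (k : ℂ) ^ 2 * (∫ τ, gu τ k * ft (fun t => α t) τ) +
        ∫ τ, gf τ k * ft (fun t => α t) τ := by
      rw [← integral_const_mul, ← integral_add i2 (i1.const_mul _),
        ← integral_add (f := fun τ => gu τ k * ((τ : ℂ) * ft (fun t => α t) τ) +
          (k : ℂ) ^ 2 * (gu τ k * ft (fun t => α t) τ)) (i2.add (i1.const_mul _)) i3]
      refine integral_congr_ae (.of_forall fun τ => ?_)
      simp only
      push_cast
      ring
    have h1 : ∫ τ, gu τ k * ft (fun t => ((deriv α t : ℝ) : ℂ)) τ =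
        -Complex.I * ∫ τ, gu τ k * ((τ : ℂ) * ft (fun t => α t) τ) := by
      rw [← integral_const_mul]
      refine integral_congr_ae (.of_forall fun τ => ?_)
      simp only [ft_deriv_ofReal hα]
      ring
    rw [hD, h1, ft_deriv_ofReal hβ.deriv, ft_deriv_ofReal hβ]
    push_cast
    field_simp
    ring_nf
    simp only [Complex.I_sq]
    ring
  obtain ⟨η, hη, hηft⟩ := exists_isTest_ft_eq_ite
  -- Tested against `η(x) e^{-ikx}`, the series over all frequencies retains only its `k`-th term.
  have h := hasSum_complexify hadd hreal hα (hη.mul_exp ((-k : ℤ) : ℝ))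
  have h0 : HasSum (fun j : ℤ => D j α * ft (fun t => η t * Complex.exp
      (Complex.I * ((((-k : ℤ) : ℝ) : ℂ) * t))) j) (D k α * (2 * π)) := by
    convert! hasSum_ite_eq k (D k α * (2 * π)) using 1
    funext j
    rw [ft_mul_exp, ← Int.cast_add, hηft]
    by_cases hj : j = k
    · subst hj; simp
    · rw [if_neg hj, if_neg (by omega), Complex.ofReal_zero, mul_zero]
  have h1 : D k α * (2 * π) = 0 := h0.unique h
  exact (mul_eq_zero.1 h1).resolve_right (by simp [hπ])

end

/-! ### Localization in time, and coincidence on `ω`. -/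

noncomputable section

theorem ft_mul_exp_neg (α : ℝ → ℂ) (η τ : ℝ) :
    ft (fun t => α t * Complex.exp (Complex.I * (((-η : ℝ) : ℂ) * t))) τ = ft α (τ - η) := by
  rw [ft_mul_exp, sub_eq_add_neg]

/-- The Fourier transform, at `-η`, of `χ` times the `k`-th Fourier coefficient, up to a
constant. -/
def localCoeff (χ : ℝ → ℂ) (g : ℝ → ℤ → ℂ) (k : ℤ) (η : ℝ) : ℂ := ∫ τ, g τ k * ft χ (τ - η)

/-- One factor `1 + |x|` comes from Peetre's inequality, the other from the factor `τ - η` produced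
by differentiating the cutoff. -/
theorem lintegral_ft_weight_lt_top {I : Set ℝ} {χ : ℝ → ℂ} (hχ : IsTest I χ) :
    ∫⁻ x, ENNReal.ofReal (1 + |x|) * (ENNReal.ofReal (1 + |x|) * ‖ft χ x‖ₑ) < ∞ := by
  obtain ⟨C, hC0, hC⟩ := ft_decay hχ.1 hχ.2 4
  refine lt_of_le_of_lt (lintegral_mono fun x => ?_)
    (integrable_inv_one_add_sq.const_mul C).lintegral_lt_top
  have hx := abs_nonneg x
  rw [← ofReal_norm, ← ENNReal.ofReal_mul (by positivity), ← ENNReal.ofReal_mul (by positivity)]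
  refine ENNReal.ofReal_le_ofReal ?_
  rw [← div_eq_mul_inv, le_div_iff₀ (by positivity)]
  refine le_trans ?_ (hC x)
  rw [show (1 + |x|) * ((1 + |x|) * ‖ft χ x‖) * (1 + x ^ 2) =
    (1 + |x|) ^ 2 * (1 + x ^ 2) * ‖ft χ x‖ by ring, show (4 : ℕ) = 2 + 2 from rfl, pow_add]
  gcongr
  rw [add_sq, sq_abs]
  nlinarith

/-- Localized in time, the solution gains the regularity `1 - b` in the variable
`τ + k²`. -/
theorem bourgainNormSq_localCoeff_lt_top {T r b : ℝ} (hb0 : 0 ≤ b) (hb1 : b ≤ 1)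
    {wu wf : 𝓓'((⊤ : Opens (ℝ × ℝ)), ℂ)} {gu gf : ℝ → ℤ → ℂ}
    (hgu : ∀ k, AEStronglyMeasurable (fun τ => gu τ k) volume)
    (hgus : bourgainNormSq r b gu < ∞) (hu : HasSpaceTimeFourier wu gu)
    (hgf : ∀ k, AEStronglyMeasurable (fun τ => gf τ k) volume)
    (hgfs : bourgainNormSq r (-b) gf < ∞) (hf : HasSpaceTimeFourier wf gf)
    (heq : schrodinger (restrict (le_top : cylinder T ⊤ ≤ ⊤) wu) = restrict le_top wf)
    {χ : ℝ → ℂ} (hχ : IsTest (Ioo 0 T) χ) :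
    bourgainNormSq r (1 - b) (fun η k => localCoeff χ gu k η) < ∞ := by
  have hb : |b| ≤ 1 := by rwa [abs_of_nonneg hb0]
  set K : ℝ → ℝ≥0∞ := fun x => ENNReal.ofReal (1 + |x|) * ‖ft χ x‖ₑ with hKdef
  have hK : Measurable K := by
    have := (continuous_ft hχ.integrable).measurable
    fun_prop
  have hpt : ∀ (k : ℤ) η, ENNReal.ofReal (bracket (η + (k : ℝ) ^ 2)) * ‖localCoeff χ gu k η‖ₑ ≤
      ∫⁻ τ, (‖gu τ k‖ₑ + ‖gf τ k‖ₑ) * K (τ - η) := by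
    intro k η
    have hα := hχ.mul_exp (-η)
    have e0 := integral_schrodinger_eq_zero hb hgu hgus hu hgf hgfs hf heq k hα
    have i1 := (integrable_schrodinger_mul_ft hb hgu hgus hgf hgfs k hα).2
    have i2 := integrable_mul_ft hb hgu hgus k hα
    simp only [ft_mul_exp_neg] at e0 i1 i2
    -- Write `η + k² = (τ + k²) - (τ - η)`: the equation replaces the first part by `-gf`, and the
    -- second is the Fourier side of `χ'u`.
    have e1 : ((η + (k : ℝ) ^ 2 : ℝ) : ℂ) * localCoeff χ gu k η =
        -∫ τ, (gu τ k * ((τ - η : ℝ) : ℂ) + gf τ k) * ft χ (τ - η) := by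
      rw [localCoeff, ← integral_const_mul, eq_neg_iff_add_eq_zero, ← e0, ← integral_add
        (i2.const_mul _)]
      · refine integral_congr_ae (.of_forall fun τ => ?_)
        simp only
        push_cast
        ring
      · refine (i1.sub (i2.const_mul ((η + (k : ℝ) ^ 2 : ℝ) : ℂ))).congr (.of_forall fun τ => ?_)
        simp only [Pi.sub_apply]
        push_cast
        ring
    calc ENNReal.ofReal (bracket (η + (k : ℝ) ^ 2)) * ‖localCoeff χ gu k η‖ₑ
        ≤ ENNReal.ofReal (1 + |η + (k : ℝ) ^ 2|) * ‖localCoeff χ gu k η‖ₑ := by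
          gcongr
          exact bracket_le_one_add_abs _
      _ = ‖localCoeff χ gu k η‖ₑ +
            ‖((η + (k : ℝ) ^ 2 : ℝ) : ℂ) * localCoeff χ gu k η‖ₑ := by
          rw [ENNReal.ofReal_add zero_le_one (abs_nonneg _), add_mul, ENNReal.ofReal_one, one_mul,
            enorm_mul, ← ofReal_norm ((_ : ℝ) : ℂ), Complex.norm_real, Real.norm_eq_abs]
      _ ≤ (∫⁻ τ, ‖gu τ k * ft χ (τ - η)‖ₑ) +
            ∫⁻ τ, ‖(gu τ k * ((τ - η : ℝ) : ℂ) + gf τ k) * ft χ (τ - η)‖ₑ := by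
          rw [e1, enorm_neg]
          exact add_le_add (enorm_integral_le_lintegral_enorm _)
            (enorm_integral_le_lintegral_enorm _)
      _ ≤ ∫⁻ τ, (‖gu τ k * ft χ (τ - η)‖ₑ +
            ‖(gu τ k * ((τ - η : ℝ) : ℂ) + gf τ k) * ft χ (τ - η)‖ₑ) := le_lintegral_add _ _
      _ ≤ _ := by
          refine lintegral_mono fun τ => ?_
          have h1 : ‖((τ - η : ℝ) : ℂ)‖ₑ = ENNReal.ofReal |τ - η| := by
            rw [← ofReal_norm, Complex.norm_real, Real.norm_eq_abs]
          simp only [hKdef, enorm_mul]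
          rw [ENNReal.ofReal_add zero_le_one (abs_nonneg _), ENNReal.ofReal_one]
          calc _ ≤ ‖gu τ k‖ₑ * ‖ft χ (τ - η)‖ₑ +
                (‖gu τ k‖ₑ * ENNReal.ofReal |τ - η| + ‖gf τ k‖ₑ) * ‖ft χ (τ - η)‖ₑ := by
                gcongr
                refine (enorm_add_le _ _).trans_eq ?_
                rw [enorm_mul, h1]
            _ ≤ ‖gu τ k‖ₑ * ‖ft χ (τ - η)‖ₑ +
                (‖gu τ k‖ₑ * ENNReal.ofReal |τ - η| + ‖gf τ k‖ₑ) * ‖ft χ (τ - η)‖ₑ +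
                ‖gf τ k‖ₑ * ENNReal.ofReal |τ - η| * ‖ft χ (τ - η)‖ₑ := le_self_add
            _ = _ := by ring
  rw [bourgainNormSq_eq]
  rw [bourgainNormSq_eq] at hgus hgfs
  set A := 4 * (∫⁻ x, ENNReal.ofReal (1 + |x|) * K x) ^ 2 with hA
  have hAtop : A < ∞ := by
    have := (lintegral_ft_weight_lt_top hχ).ne
    simp only [hA, hKdef]
    finiteness
  calc _ ≤ ∑' k : ℤ, ENNReal.ofReal (freq k ^ (2 * r)) * (A *
        ((∫⁻ τ, ENNReal.ofReal (bracket (τ + (k : ℝ) ^ 2) ^ (2 * b)) * ‖gu τ k‖ₑ ^ 2) +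
        ∫⁻ τ, ENNReal.ofReal (bracket (τ + (k : ℝ) ^ 2) ^ (2 * (-b))) * ‖gf τ k‖ₑ ^ 2)) :=
        ENNReal.tsum_le_tsum fun k => mul_le_mul' le_rfl
          (lintegral_bracket_conv_le hb0 hb1 (hgu k) (hgf k) hK (hpt k))
    _ = A * (_ + _) := by
        rw [← ENNReal.tsum_add, ← ENNReal.tsum_mul_left]
        congr 1; funext k
        rw [mul_left_comm, mul_add]
    _ < ∞ := ENNReal.mul_lt_top hAtop (ENNReal.add_lt_top.2 ⟨hgus, hgfs⟩)

theorem lintegral_ft_neg_sq {d : ℝ → ℂ} (hd : Integrable d) (hd2 : MemLp d 2) :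
    ∫⁻ η, ‖2 * π * ft d (-η)‖ₑ ^ 2 = ENNReal.ofReal (2 * π) ^ 3 * ∫⁻ t, ‖d t‖ₑ ^ 2 := by
  have hπ := Real.pi_pos
  have h1 : ‖(2 * π : ℂ)‖ₑ = ENNReal.ofReal (2 * π) := by
    rw [← ofReal_norm, norm_mul, Complex.norm_real, Complex.norm_ofNat,
      Real.norm_of_nonneg hπ.le]
  simp only [enorm_mul (2 * π : ℂ), mul_pow, h1]
  rw [lintegral_const_mul' _ _ (by finiteness), lintegral_neg_eq_self (fun η => ‖ft d η‖ₑ ^ 2),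
    lintegral_ft_sq hd hd2]
  ring

/-- Apply the duality to `ψ(t) = χ(t) e^{-iηt}`. This brings `localCoeff` back to functions of `t`,
where Plancherel applies. -/
theorem localCoeff_eq_ft {I : Set ℝ} {g : ℝ → ℤ → ℂ} {k : ℤ} {v : ℝ → ℂ}
    (hv : ∀ ψ : ℝ → ℂ, Integrable ψ → MemLp ψ 2 →
      ∫ τ, g τ k * ft ψ τ = 2 * π * ∫ t, v t * ψ t) {χ : ℝ → ℂ} (hχ : IsTest I χ) (η : ℝ) :
    localCoeff χ g k η = 2 * π * ft (fun t => v t * χ t) (-η) := by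
  have h := hv _ (hχ.mul_exp (-η)).integrable ((hχ.mul_exp (-η)).memLp 2)
  simp only [ft_mul_exp_neg] at h
  rw [localCoeff, h]
  simp only [ft, mul_assoc]

/-- `L²_loc` coefficients are integrable against test functions. -/
theorem integrableOn_mul_test {T : ℝ} {c : ℝ → ℂ}
    (hc : AEStronglyMeasurable c (volume.restrict (Ioo 0 T)))
    (hloc : ∀ K : Set ℝ, IsCompact K → K ⊆ Ioo 0 T → ∫⁻ t in K, ‖c t‖ₑ ^ 2 < ∞)
    {α : ℝ → ℂ} (hα : IsTest (Ioo 0 T) α) :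
    IntegrableOn (fun t => c t * α t) (Ioo 0 T) := by
  have hK : IsCompact (tsupport α) := hα.2
  have h1 : IntegrableOn (fun t => c t * α t) (tsupport α) :=
    (memLp_two_of_lintegral_lt_top (hc.mono_measure (Measure.restrict_mono hα.3 le_rfl))
      (hloc _ hK hα.3)).integrable_mul ((hα.memLp 2).mono_measure Measure.restrict_le_self)
  refine h1.of_forall_sdiff_eq_zero measurableSet_Ioo fun t ht => ?_
  simp [image_eq_zero_of_notMem_tsupport ht.2]

theorem lintegral_lt_top_of_sobolevNormSq {s : ℝ} {c : ℝ → ℤ → ℂ} {K : Set ℝ}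
    (h : ∫⁻ t in K, sobolevNormSq s (c t) < ∞) (k : ℤ) : ∫⁻ t in K, ‖c t k‖ₑ ^ 2 < ∞ := by
  have h1 : ∫⁻ t in K, ENNReal.ofReal (freq k ^ (2 * s)) * ‖c t k‖ₑ ^ 2 < ∞ :=
    lt_of_le_of_lt (lintegral_mono fun t => ENNReal.le_tsum k) h
  rw [lintegral_const_mul' _ _ ENNReal.ofReal_ne_top] at h1
  refine ENNReal.lt_top_of_mul_ne_top_right h1.ne ?_
  simpa using Real.rpow_pos_of_pos (freq_pos k) _

/-- Two distributions that coincide on `]0,T[ × ω`, tested against a product of complex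
functions. -/
theorem hasSum_localCoeff_sub {T s r b : ℝ} (hb : |b| ≤ 1) {ω : Opens Torus}
    {w : 𝓓'((⊤ : Opens (ℝ × ℝ)), ℂ)} {g : ℝ → ℤ → ℂ}
    (hg : ∀ k, AEStronglyMeasurable (fun τ => g τ k) volume)
    (hgs : bourgainNormSq r b g < ∞) (hw : HasSpaceTimeFourier w g)
    {v : 𝓓'(cylinder T ⊤, ℂ)} {c : ℝ → ℤ → ℂ}
    (hc : ∀ k, AEStronglyMeasurable (fun t => c t k) (volume.restrict (Ioo 0 T)))
    (hcs : ∀ K : Set ℝ, IsCompact K → K ⊆ Ioo 0 T → ∫⁻ t in K, sobolevNormSq s (c t) < ∞)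
    (hv : HasSpaceFourier T v c)
    (heq : restrict (cylinder_mono T (le_top : ω ≤ ⊤)) (restrict le_top w) =
      restrict (cylinder_mono T (le_top : ω ≤ ⊤)) v)
    {χ φ : ℝ → ℂ} (hχ : IsTest (Ioo 0 T) χ)
    (hφ : IsTest {x : ℝ | (x : Torus) ∈ ω} φ) (n : ℤ) (η : ℝ) :
    HasSum (fun k : ℤ => ft φ ((k - n : ℤ) : ℝ) * (localCoeff χ g k η -
      2 * π * ft ((Ioo 0 T).indicator fun t => c t k * χ t) (-η))) 0 := by
  have hπ : (π : ℂ) ≠ 0 := by exact_mod_cast Real.pi_ne_zero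
  have ic : ∀ k : ℤ, ∀ {α : ℝ → ℂ}, IsTest (Ioo 0 T) α →
      IntegrableOn (fun t => c t k * α t) (Ioo 0 T) := fun k _ h =>
    integrableOn_mul_test (hc k)
      (fun K hK hKT => lintegral_lt_top_of_sobolevNormSq (hcs K hK hKT) k) h
  set D : ℤ → (ℝ → ℂ) → ℂ := fun k α =>
    (2 * π : ℂ)⁻¹ * (∫ τ, g τ k * ft α τ) - ∫ t in Ioo 0 T, c t k * α t with hDdef
  have hadd : ∀ k, ∀ α₁ α₂ : ℝ → ℂ, IsTest (Ioo 0 T) α₁ → IsTest (Ioo 0 T) α₂ →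
      D k (fun t => α₁ t + Complex.I * α₂ t) = D k α₁ + Complex.I * D k α₂ := by
    intro k α₁ α₂ h1 h2
    have e1 : ∫ τ, g τ k * ft (fun t => α₁ t + Complex.I * α₂ t) τ =
        (∫ τ, g τ k * ft α₁ τ) + Complex.I * ∫ τ, g τ k * ft α₂ τ := by
      rw [← integral_const_mul, ← integral_add (integrable_mul_ft hb hg hgs k h1)
        ((integrable_mul_ft hb hg hgs k h2).const_mul _)]
      congr 1; funext τ
      rw [ft_add h1.integrable (h2.integrable.const_mul _), ft_const_mul]
      ring
    have e2 : ∫ t in Ioo 0 T, c t k * (α₁ t + Complex.I * α₂ t) =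
        (∫ t in Ioo 0 T, c t k * α₁ t) + Complex.I * ∫ t in Ioo 0 T, c t k * α₂ t := by
      rw [← integral_const_mul, ← integral_add (ic k h1) ((ic k h2).const_mul _)]
      congr 1; funext t
      ring
    simp only [hDdef, e1, e2]
    ring
  have hreal : ∀ α β : ℝ → ℝ, IsTest (Ioo 0 T) α → IsTest {x : ℝ | (x : Torus) ∈ ω} β →
      HasSum (fun k : ℤ => D k (fun t => α t) * ft (fun x => β x) k) 0 := by
    intro α β hα hβ
    have hβ' := hβ.mono (subset_univ _)
    have hU : Ioo 0 T ×ˢ {x : ℝ | (x : Torus) ∈ ω} ⊆ (cylinder T ω : Set (ℝ × ℝ)) :=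
      fun p hp => hp
    have hloc : ∀ y : 𝓓'(cylinder T ⊤, ℂ), restrict (cylinder_mono T (le_top : ω ≤ ⊤)) y
        (tensorTest _ hα hβ hU) = y (tensorTest _ hα hβ' (prod_univ_subset_cylinder T)) := by
      intro y
      obtain ⟨ψ, hψ, hres⟩ := restrict_apply (cylinder_mono T (le_top : ω ≤ ⊤)) y
        (tensorTest _ hα hβ hU)
      rw [hres]
      congr 1
      exact DFunLike.coe_injective hψ
    have e1 := hasSum_tensorTest_of_hasSpaceTimeFourier hw hα hβ'
    have e2 := hasSum_tensorTest_of_hasSpaceFourier hv hα hβ'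
    have e3 := e1.sub e2
    rw [← hloc, ← hloc, heq, sub_self] at e3
    convert! e3 using 1
    funext k
    simp only [hDdef]
    ring
  -- Testing against `χ(t) e^{-iηt}` and `φ(x) e^{-inx}` reads off the Fourier transform of `φχ(u -
  -- v)` at `(η, n)`.
  have h := (hasSum_complexify hadd hreal (hχ.mul_exp (-η))
    (hφ.mul_exp ((-n : ℤ) : ℝ))).mul_left (2 * π : ℂ)
  rw [mul_zero] at h
  convert! h using 1
  funext k
  have e1 : ft ((Ioo 0 T).indicator fun t => c t k * χ t) (-η) =
      ∫ t in Ioo 0 T, c t k * (χ t * Complex.exp (Complex.I * (((-η : ℝ) : ℂ) * t))) := by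
    rw [ft, ← integral_indicator measurableSet_Ioo]
    refine integral_congr_ae (.of_forall fun t => ?_)
    simp only [indicator]
    split_ifs
    · ring
    · simp
  simp only [hDdef]
  rw [e1, ft_mul_exp, ← Int.cast_add, ← sub_eq_add_neg]
  simp only [ft_mul_exp_neg]
  rw [localCoeff]
  field_simp

end

/-! ### From space-time coefficients to functions of time, and conclusion. -/

noncomputable section

/-- The Fourier coefficients in `x` of a distribution in a Bourgain space with `b ≥ 0` are the
inverse Fourier transforms of its space-time Fourier transform. -/
theorem hasSpaceFourier_restrict {T : ℝ} {w : 𝓓'((⊤ : Opens (ℝ × ℝ)), ℂ)} {g : ℝ → ℤ → ℂ}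
    (hw : HasSpaceTimeFourier w g) {v : ℤ → ℝ → ℂ}
    (hv : ∀ k, ∀ ψ : ℝ → ℂ, Integrable ψ → MemLp ψ 2 →
      ∫ τ, g τ k * ft ψ τ = 2 * π * ∫ t, v k t * ψ t) :
    HasSpaceFourier T (restrict le_top w) (fun t k => v k t) := by
  intro φ
  have hπ : (π : ℂ) ≠ 0 := by exact_mod_cast Real.pi_ne_zero
  obtain ⟨φ', hφ', hres⟩ := restrict_apply le_top w φ
  rw [hres]
  convert! hw φ' using 1
  funext k
  rw [hφ']
  have hφc : Continuous φ := φ.continuous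
  -- A general test function enters the `k`-th term only through its partial transform in `x`, which
  -- is an admissible `ψ` for the duality in `hv`.
  set Ψ : ℝ → ℂ := fun t => ∫ x : ℝ, (φ (t, x) : ℂ) * Complex.exp (Complex.I * (k * x)) with hΨ
  have hcpt : IsCompact (tsupport φ) := φ.hasCompactSupport
  have hzero : ∀ t x, (t, x) ∉ tsupport φ → φ (t, x) = 0 := fun t x h =>
    image_eq_zero_of_notMem_tsupport h
  have hΨc : Continuous Ψ := by
    have h := continuous_parametric_integral_of_continuous (μ := (volume : Measure ℝ))
      (f := fun t x : ℝ => (φ (t, x) : ℂ) * Complex.exp (Complex.I * (k * x)))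
      (by fun_prop) (hcpt.image continuous_snd)
    convert! h using 1
    funext t
    refine (setIntegral_eq_integral_of_forall_compl_eq_zero fun x hx => ?_).symm
    rw [hzero t x fun h => hx ⟨_, h, rfl⟩, Complex.ofReal_zero, zero_mul]
  have hΨs : HasCompactSupport Ψ := by
    refine HasCompactSupport.intro (hcpt.image continuous_fst) fun t ht => ?_
    rw [hΨ]
    refine integral_eq_zero_of_ae (.of_forall fun x => ?_)
    simp [hzero t x fun h => ht ⟨_, h, rfl⟩]
  have hft : ∀ τ : ℝ, ft Ψ τ =
      ∫ p : ℝ × ℝ, (φ p : ℂ) * Complex.exp (Complex.I * (τ * p.1 + k * p.2)) := by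
    intro τ
    rw [Measure.volume_eq_prod, integral_prod]
    · rw [ft]
      congr 1; funext t
      rw [hΨ, ← integral_mul_const]
      congr 1; funext x
      rw [mul_add, Complex.exp_add]
      ring
    · rw [← Measure.volume_eq_prod]
      refine Continuous.integrable_of_hasCompactSupport (by fun_prop) ?_
      exact HasCompactSupport.mul_right (φ.hasCompactSupport.comp_left Complex.ofReal_zero)
  simp only [← hft]
  rw [hv k Ψ (hΨc.integrable_of_hasCompactSupport hΨs) (hΨc.memLp_of_hasCompactSupport hΨs),
    setIntegral_eq_integral_of_forall_compl_eq_zero]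
  · rw [← mul_assoc, inv_mul_cancel₀ (by simp [hπ]), one_mul]
  · intro t ht
    have : Ψ t = 0 := by
      rw [hΨ]
      refine integral_eq_zero_of_ae (.of_forall fun x => ?_)
      simp [hzero t x fun h => ht (φ.tsupport_subset h).1]
    rw [show (∫ x : ℝ, (φ (t, x) : ℂ) * Complex.exp (Complex.I * (k * x))) = 0 from this, mul_zero]

theorem rapidDecay_ft {I : Set ℝ} {φ : ℝ → ℂ} (hφ : IsTest I φ) :
    RapidDecay fun m : ℤ => ft φ (m : ℝ) := fun N => by
  obtain ⟨C, -, hC⟩ := ft_decay hφ.1 hφ.2 N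
  exact ⟨C, fun m => hC m⟩

/-- For `b ≥ 0` the weight in `τ` is at least `1`; thus each coefficient of `u` is a genuine `L²`
function of time. -/
theorem memLp_two_of_bourgainNormSq {s b : ℝ} (hb : 0 ≤ b) {g : ℝ → ℤ → ℂ}
    (hg : ∀ k, AEStronglyMeasurable (fun τ => g τ k) volume) (hgs : bourgainNormSq s b g < ∞)
    (k : ℤ) : MemLp (fun τ => g τ k) 2 := by
  refine memLp_two_of_lintegral_lt_top (hg k)
    (lt_of_le_of_lt (lintegral_mono fun τ => ?_) (lintegral_lt_top_of_bourgainNormSq hgs k))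
  refine le_mul_of_one_le_left' ?_
  rw [ENNReal.one_le_ofReal]
  exact Real.one_le_rpow (one_le_bracket _) (by linarith)

theorem nonempty_lift {ω : Opens Torus} (hω : (ω : Set Torus).Nonempty) :
    {x : ℝ | (x : Torus) ∈ ω}.Nonempty := by
  obtain ⟨y, hy⟩ := hω
  obtain ⟨x, rfl⟩ := QuotientAddGroup.mk_surjective y
  exact ⟨x, hy⟩

theorem isOpen_lift (ω : Opens Torus) : IsOpen {x : ℝ | (x : Torus) ∈ ω} :=
  ω.isOpen.preimage (AddCircle.continuous_mk' (2 * π))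

/-- Truncating in time coefficients that are in `L²_loc(]0,T[, H^s)`. -/
theorem tsum_lintegral_truncation_lt_top {T s : ℝ} {c : ℝ → ℤ → ℂ}
    (hc : ∀ k, AEStronglyMeasurable (fun t => c t k) (volume.restrict (Ioo 0 T)))
    (hcs : ∀ K : Set ℝ, IsCompact K → K ⊆ Ioo 0 T → ∫⁻ t in K, sobolevNormSq s (c t) < ∞)
    {χ : ℝ → ℂ} (hχ : IsTest (Ioo 0 T) χ) (hχ1 : ∀ t, ‖χ t‖ ≤ 1) :
    ∑' k : ℤ, ENNReal.ofReal (freq k ^ (2 * s)) *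
      ∫⁻ t, ‖(Ioo 0 T).indicator (fun t => c t k * χ t) t‖ₑ ^ 2 < ∞ := by
  refine lt_of_le_of_lt ?_ (hcs (tsupport χ) hχ.2 hχ.3)
  have hm : ∀ k : ℤ, AEMeasurable (fun t => ENNReal.ofReal (freq k ^ (2 * s)) * ‖c t k‖ₑ ^ 2)
      (volume.restrict (tsupport χ)) := fun k =>
    (((hc k).mono_measure (Measure.restrict_mono hχ.3 le_rfl)).enorm.pow_const _).const_mul _
  unfold sobolevNormSq
  rw [lintegral_tsum hm]
  refine ENNReal.tsum_le_tsum fun k => ?_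
  rw [lintegral_const_mul' _ _ ENNReal.ofReal_ne_top]
  refine mul_le_mul' le_rfl ?_
  rw [← lintegral_indicator (isClosed_tsupport χ).measurableSet]
  refine lintegral_mono fun t => ?_
  by_cases ht : t ∈ tsupport χ
  · rw [indicator_of_mem (hχ.3 ht), indicator_of_mem ht, enorm_mul]
    gcongr
    refine mul_le_of_le_one_right' ?_
    rw [← ofReal_norm]
    exact ENNReal.ofReal_le_one.2 (hχ1 t)
  · simp [indicator, image_eq_zero_of_notMem_tsupport ht]

end

end SchrodingerTorus

open SchrodingerTorus in
theorem mainTheorem7 (T b r ρ : ℝ) (hT : 0 < T) (hb0 : 0 ≤ b) (hb1 : b < 1)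
    (hρ : ρ ≤ (1 - b) / 2)
    (u f : Distribution (SchrodingerTorus.cylinder T ⊤) ℂ ⊤)
    (hu : SchrodingerTorus.MemXT r b T u)
    (hf : SchrodingerTorus.MemXT r (-b) T f)
    (huf : SchrodingerTorus.schrodinger u = f)
    (ω : TopologicalSpace.Opens SchrodingerTorus.Torus)
    (hω : (ω : Set SchrodingerTorus.Torus).Nonempty)
    (hreg : SchrodingerTorus.MemL2locHOn (r + ρ) T ω u) :
    SchrodingerTorus.MemL2locH (r + ρ) T u := by
  obtain ⟨wu, ⟨gu, hgu, hgus, hwu⟩, rfl⟩ := hu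
  obtain ⟨wf, ⟨gf, hgf, hgfs, hwf⟩, rfl⟩ := hf
  obtain ⟨v, ⟨c, hc, hcs, hv⟩, heq⟩ := hreg
  have hπ := Real.pi_pos
  have hb : |b| ≤ 1 := by rw [abs_of_nonneg hb0]; exact hb1.le
  choose V hV2 hV using fun k => exists_inverse_ft (memLp_two_of_bourgainNormSq hb0 hgu hgus k)
  refine ⟨fun t k => V k t, fun k => (hV2 k).1.mono_measure Measure.restrict_le_self,
    fun K hK hKT => ?_, hasSpaceFourier_restrict hwu hV⟩
  -- The coefficients `V` do not depend on `K`; only the cutoff does, and it equals `1` on `K`.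
  obtain ⟨χ₀, hχ₀, hχK, hχ1⟩ := exists_cutoff hT hK hKT
  set χ : ℝ → ℂ := fun t => χ₀ t with hχdef
  have hχ : IsTest (Ioo 0 T) χ := hχ₀.ofReal
  have hχ1' : ∀ t, ‖χ t‖ ≤ 1 := fun t => by rw [hχdef, Complex.norm_real]; exact hχ1 t
  obtain ⟨φ, hφ, hφ0⟩ := exists_bump (isOpen_lift ω) (nonempty_lift hω)
  set d : ℤ → ℝ → ℂ := fun k => (Ioo 0 T).indicator fun t => c t k * χ t with hd
  have hds := tsum_lintegral_truncation_lt_top hc hcs hχ hχ1'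
  have hd1 : ∀ k, Integrable (d k) := fun k =>
    (integrable_indicator_iff measurableSet_Ioo).2 (integrableOn_mul_test (hc k)
      (fun K hK hKT => lintegral_lt_top_of_sobolevNormSq (hcs K hK hKT) k) hχ)
  have hfreq : ∀ k, ENNReal.ofReal (freq k ^ (2 * (r + ρ))) ≠ 0 := fun k => by
    simpa using Real.rpow_pos_of_pos (freq_pos k) _
  have hd2 : ∀ k, MemLp (d k) 2 := fun k =>
    memLp_two_of_lintegral_lt_top (hd1 k).1
      (ENNReal.lt_top_of_mul_ne_top_right ((ENNReal.le_tsum k).trans_lt hds).ne (hfreq k))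
  have he1 : ∀ k, Integrable fun t => V k t * χ t := fun k => (hV2 k).integrable_mul (hχ.memLp 2)
  have he2 : ∀ k, MemLp (fun t => V k t * χ t) 2 := fun k => by
    refine (hV2 k).of_le (he1 k).1 (.of_forall fun t => ?_)
    rw [norm_mul]
    exact mul_le_of_le_one_right (norm_nonneg _) (hχ1' t)
  have hcont : ∀ {e : ℝ → ℂ}, Integrable e →
      AEStronglyMeasurable (fun η => 2 * (π : ℂ) * ft e (-η)) volume := fun he =>
    (continuous_const.mul ((continuous_ft he).comp continuous_neg)).aestronglyMeasurable
  have hGeq : ∀ k, localCoeff χ gu k = fun η => 2 * π * ft (fun t => V k t * χ t) (-η) :=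
    fun k => funext fun η => localCoeff_eq_ft (hV k) hχ η
  -- With `σ = 1 - b`, the condition `s ≤ r + σ / 2` is exactly `ρ ≤ (1 - b) / 2`.
  have hcore := tsum_lintegral_lt_top_of_bourgain (σ := 1 - b) (s := r + ρ) (r := r)
    (by linarith) (by linarith) (by linarith) (rapidDecay_ft hφ)
    (by simpa using hφ0) (G := localCoeff χ gu) (C := fun k η => 2 * π * ft (d k) (-η))
    (fun k => by rw [hGeq]; exact hcont (he1 k))
    (bourgainNormSq_localCoeff_lt_top hb0 hb1.le hgu hgus hwu hgf hgfs hwf huf hχ)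
    (fun k => hcont (hd1 k)) ?_
    (fun n η => hasSum_localCoeff_sub hb hgu hgus hwu hc hcs hv heq hχ hφ n η)
  · have hterm : ∀ k, ∫⁻ η, ENNReal.ofReal (freq k ^ (2 * (r + ρ))) * ‖localCoeff χ gu k η‖ₑ ^ 2 =
        ENNReal.ofReal (2 * π) ^ 3 *
          (ENNReal.ofReal (freq k ^ (2 * (r + ρ))) * ∫⁻ t, ‖V k t * χ t‖ₑ ^ 2) := fun k => by
      rw [lintegral_const_mul' _ _ ENNReal.ofReal_ne_top, hGeq, lintegral_ft_neg_sq (he1 k) (he2 k)]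
      ring
    simp only [hterm] at hcore
    rw [ENNReal.tsum_mul_left] at hcore
    have hfin := ENNReal.lt_top_of_mul_ne_top_right hcore.ne (by simpa using hπ)
    refine lt_of_le_of_lt ?_ hfin
    unfold sobolevNormSq
    rw [lintegral_tsum fun k =>
      ((hV2 k).1.mono_measure Measure.restrict_le_self).enorm.pow_const _ |>.const_mul _]
    refine ENNReal.tsum_le_tsum fun k => ?_
    rw [lintegral_const_mul' _ _ ENNReal.ofReal_ne_top]
    refine mul_le_mul' le_rfl ?_
    rw [← lintegral_indicator hK.measurableSet]
    refine lintegral_mono fun t => ?_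
    by_cases ht : t ∈ K
    · rw [indicator_of_mem ht, hχdef]
      simp [hχK t ht]
    · rw [indicator_of_notMem ht]
      exact zero_le
  · have hterm : ∀ k, ∫⁻ η, ENNReal.ofReal (freq k ^ (2 * (r + ρ))) *
        ‖2 * (π : ℂ) * ft (d k) (-η)‖ₑ ^ 2 = ENNReal.ofReal (2 * π) ^ 3 *
          (ENNReal.ofReal (freq k ^ (2 * (r + ρ))) * ∫⁻ t, ‖d k t‖ₑ ^ 2) := fun k => by
      rw [lintegral_const_mul' _ _ ENNReal.ofReal_ne_top, lintegral_ft_neg_sq (hd1 k) (hd2 k)]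
      ring
    simp only [hterm]
    rw [ENNReal.tsum_mul_left]
    exact ENNReal.mul_lt_top (by finiteness) hds
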